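/- **MPC protocols.** Let $\gamma,\delta>0$. Let $p(n)=\Theta(\log n)$ be a word length; a word is an element of $\mathbb Z_{2^{p}}$, $p=p(n)$. A (deterministic) $R$-round $(\gamma,\delta)$-MPC protocol, where $R=R(n)$ may depend on $n$, consists for every input size $n$ of $q=\Theta(n^{1+\gamma-\delta})$ machines, each with local memory for $s=O(n^{\delta})$ words ($s\ge 1$, $\lceil n/s\rceil\le q$), that work as follows. * The input $X\in\mathbb Z_{2^p}^n$ is split into consecutive blocks of $s$ words, held in the local memories of the first $\lceil n/s\rceil$ machines. * In each of the $R$ rounds, each machine applies an arbitrary function (depending on $n$, the machine and the round) to its local memory, which determines a (possibly empty) sequence of words to be sent to each machine, itself included; an empty sequence means no message. On every input, each machine sends at most $s$ words and receives at most $s$ words in each round. Its new local memory is the collection of the messages received, each labelled by its sender. * The output is the concatenation of the local memories of the first $\lceil n/s\rceil$ machines after the last round (within a machine, the messages are concatenated in the order of the senders). The protocol computes $f=(f_n)_n$, $f_n:\mathbb Z_{2^p}^n\to\mathbb Z_{2^p}^n$, if for all $n$ and $X$ its output on $X$ is $f_n(X)$. For $\rho>0$, a $(\gamma,\delta,\rho)$-MPC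 protocol is a $(\gamma,\delta)$-MPC protocol such that, for some $k=O(n^{\rho})$, in every round on every input each machine sends messages to at most $k$ machines and receives messages from at most $k$ machines. Here $\Theta$ and $O$ refer to $n\to\infty$, with implied constants that may depend on the protocol. **Proposition.** There is an absolute constant $C>0$ such that the following holds. Let $\gamma,\delta>0$ and $\rho\in(0,\delta/2)$. If $f$ can be computed by an $R$-round $(\gamma,\delta)$-MPC protocol, then $f$ can be computed by an $R'$-round $(\gamma,\delta,\rho)$-MPC protocol (with the same word length) with $$R'(n)\;\le\; C\cdot\frac{R(n)\,(1+\gamma)^2}{\rho^2}\qquad\text{for all } n.$$ -/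

import Mathlib

open Filter Asymptotics

namespace MPC

/-- A `p`-bit word. -/
abbrev Word (p : ℕ) := ZMod (2 ^ p)

/-- The contents of one machine's mailbox, among `q` machines: for each partner machine, a message,
which is a finite sequence of words. The empty sequence means that there is no message.
As an inbox it is indexed by the senders, as an outbox by the recipients. -/
abbrev Mailbox (p q : ℕ) := Fin q → List (Word p)

/-- The number of words in a mailbox. -/
def Mailbox.size {p q : ℕ} (m : Mailbox p q) : ℕ := ∑ j, (m j).length

/-- The number of partner machines with which a (nonempty) message is exchanged. -/
def Mailbox.partners {p q : ℕ} (m : Mailbox p q) : ℕ :=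
  (Finset.univ.filter fun j => m j ≠ []).card

/-- The concatenation of all messages in a mailbox, in the order of the machines. -/
def Mailbox.concat {p q : ℕ} (m : Mailbox p q) : List (Word p) := (List.ofFn m).flatten

/-- A deterministic `R`-round message-passing protocol for inputs of `n` words of `p` bits: there are
`q` machines, each with local memory for `s` words, and in round `t` the machine `i` applies the
arbitrary function `step t i` to its local memory, which yields the messages that it sends. -/
structure Protocol (n p R : ℕ) where
  q : ℕ
  s : ℕ
  s_pos : 0 < s
  /-- There are enough machines to hold the input. -/
  ceilDiv_le : n ⌈/⌉ s ≤ q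
  step : Fin R → Fin q → Mailbox p q → Mailbox p q

namespace Protocol

variable {n p R : ℕ} (π : Protocol n p R)

/-- The initial local memory of machine `i`: the `i`-th block of `s` consecutive input words (the
last block may be shorter, and it is empty from machine number `⌈n / s⌉` on), filed as a message of
the machine to itself. -/
def initial (X : Fin n → Word p) (i : Fin π.q) : Mailbox p π.q :=
  fun j => if j = i then ((List.ofFn X).drop (i * π.s)).take π.s else []

/-- The local memory of machine `i` after `t` rounds: the messages that it received in the last of
them. (After round `R` nothing changes any more.) -/
def memory (X : Fin n → Word p) : ℕ → Fin π.q → Mailbox p π.q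
  | 0 => π.initial X
  | t + 1 =>
    if h : t < R then fun i j => π.step ⟨t, h⟩ j (memory X t j) i else memory X t

/-- The messages sent by machine `i` in round `t`, indexed by their recipients. -/
def sent (X : Fin n → Word p) (t : Fin R) (i : Fin π.q) : Mailbox p π.q :=
  π.step t i (π.memory X t i)

/-- The messages received by machine `i` in round `t`, indexed by their senders. -/
def received (X : Fin n → Word p) (t : Fin R) (i : Fin π.q) : Mailbox p π.q :=
  fun j => π.sent X t j i

/-- In each round, on each input, each machine sends at most `s` words and receives at most `s`
words. -/
def RespectsMemory : Prop :=
  ∀ (X : Fin n → Word p) (t : Fin R) (i : Fin π.q),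
    (π.sent X t i).size ≤ π.s ∧ (π.received X t i).size ≤ π.s

/-- In each round, on each input, each machine sends messages to at most `k` machines and receives
messages from at most `k` machines. -/
def RespectsCapacity (k : ℕ) : Prop :=
  ∀ (X : Fin n → Word p) (t : Fin R) (i : Fin π.q),
    (π.sent X t i).partners ≤ k ∧ (π.received X t i).partners ≤ k

/-- The concatenation of the local memories of the first `⌈n / s⌉` machines after the final round. -/
def output (X : Fin n → Word p) : List (Word p) :=
  ((List.finRange π.q).take (n ⌈/⌉ π.s)).flatMap fun i => (π.memory X R i).concat

/-- The protocol computes the function `f` on sequences of `n` words. -/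
def Computes (f : (Fin n → Word p) → (Fin n → Word p)) : Prop :=
  ∀ X : Fin n → Word p, π.output X = List.ofFn (f X)

end Protocol

/-- `π` is a `(γ, δ)`-MPC protocol with `R n` rounds on inputs of `n` words of `p n` bits. -/
structure IsMPC (γ δ : ℝ) {p R : ℕ → ℕ} (π : ∀ n, Protocol n (p n) (R n)) : Prop where
  wordBits : (fun n => (p n : ℝ)) =Θ[atTop] fun n : ℕ => Real.log n
  machines : (fun n => ((π n).q : ℝ)) =Θ[atTop] fun n : ℕ => (n : ℝ) ^ (1 + γ - δ)
  localMemory : (fun n => ((π n).s : ℝ)) =O[atTop] fun n : ℕ => (n : ℝ) ^ δ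
  respectsMemory : ∀ n, (π n).RespectsMemory

/-- `π` is a `(γ, δ, ρ)`-MPC protocol: a `(γ, δ)`-MPC protocol in which, for some capacity
`k = O(n ^ ρ)`, each machine exchanges messages with at most `k` machines per round. -/
structure IsRestrictedMPC (γ δ ρ : ℝ) {p R : ℕ → ℕ} (π : ∀ n, Protocol n (p n) (R n)) : Prop
    extends IsMPC γ δ π where
  capacity : ∃ k : ℕ → ℕ, (fun n => (k n : ℝ)) =O[atTop] (fun n : ℕ => (n : ℝ) ^ ρ) ∧
    ∀ n, (π n).RespectsCapacity (k n)

end MPC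

namespace MPC

/-! ### Building protocols round by round. -/

section Reachability

variable {n p q s : ℕ}

/-! The protocol is simulated on `k ^ d` machines indexed by strings of `d` digits below `k`, where
`d = ⌈(1 + γ) / ρ⌉` is constant and `k = O(n ^ ρ)`. While words are being routed, a machine talks in
each round only along one coordinate line of this grid, so it has at most `k` partners. One round of
the given protocol becomes one round of local computation followed by routing each word to the host
of its recipient. Words travel as packets labelled by sender, recipient and position. There are
polynomially many possible packets and `p = Θ(log n)`, so a packet fits into a constant number `c`
of words.

Correcting the digits of the location one after another could pile up packets at an intermediate
machine. Therefore, before digit `j` is corrected, every machine splits its packets into `k` classes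
by the `j`-th digit of the destination and deals each class evenly along the line in direction `i`,
for each `i > j` in turn (`Balanced.insert`). The packets that then arrive at a machine are, up to
the rounding of the deals, the average over the subgrid of directions `> j` of packets destined for
that subgrid. This gives a load of at most `M + d * k ^ 2`, where `M` bounds the number of packets
per source and per destination (`Balanced.card_packetsAt_correct_le`). The bound does not involve
the load before the stage, so errors do not accumulate over the digits.

The error `k ^ 2 = O(n ^ (2ρ))` is affordable because `2ρ < δ`. The given memory may be much smaller
than `n ^ δ`, so each host simulates `g` consecutive machines, with `g * s` at least `n ^ δ`.
Routing takes at most `d ^ 2` rounds (`PacketReachable.route`), and three extra rounds serve input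
and output (`Protocol.exists_simulation`). Sizes `n` for which the asymptotic bounds fail keep the
original protocol (`Protocol.exists_restricted`). -/

theorem Protocol.memory_congr {T T' : ℕ} (hs : 0 < s) (hq : n ⌈/⌉ s ≤ q)
    (step : Fin T → Fin q → Mailbox p q → Mailbox p q)
    (step' : Fin T' → Fin q → Mailbox p q → Mailbox p q) (m : ℕ) (hm : m ≤ T) (hm' : m ≤ T')
    (h : ∀ t (ht : t < m), step ⟨t, by omega⟩ = step' ⟨t, by omega⟩) (X : Fin n → Word p) :
    (Protocol.mk q s hs hq step).memory X m = (Protocol.mk q s hs hq step').memory X m := by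
  induction m with
  | zero => rfl
  | succ m ih =>
    have ih := ih (by omega) (by omega) fun t ht => h t (by omega)
    simp only [Protocol.memory, show m < T by omega, show m < T' by omega, dite_true, ih,
      h m (by omega)]

/-- The memory contents `A`, as functions of the input, can be produced in `T` rounds by a protocol
with `q` machines, local memory for `s` words and capacity `k`. -/
def Reachable (hs : 0 < s) (hq : n ⌈/⌉ s ≤ q) (k T : ℕ)
    (A : (Fin n → Word p) → Fin q → Mailbox p q) : Prop :=
  ∃ step : Fin T → Fin q → Mailbox p q → Mailbox p q,
    (Protocol.mk q s hs hq step).RespectsMemory ∧ (Protocol.mk q s hs hq step).RespectsCapacity k ∧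
      ∀ X, (Protocol.mk q s hs hq step).memory X T = A X

variable {hs : 0 < s} {hq : n ⌈/⌉ s ≤ q} {k T : ℕ} {A B : (Fin n → Word p) → Fin q → Mailbox p q}

theorem Reachable.zero : Reachable (p := p) hs hq k 0
    (fun X i j => if j = i then ((List.ofFn X).drop (i * s)).take s else []) :=
  ⟨fun t => t.elim0, fun _ t => t.elim0, fun _ t => t.elim0, fun _ => rfl⟩

/-- One more round can produce `B` from `A` as soon as the messages sent by each machine are
determined by its memory, and the bounds on memory and capacity are respected. -/
theorem Reachable.succ (h : Reachable hs hq k T A)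
    (hloc : ∀ X Y w, A X w = A Y w → ∀ v, B X v w = B Y v w)
    (hsent : ∀ X w, Mailbox.size (fun v => B X v w) ≤ s)
    (hrecv : ∀ X v, Mailbox.size (B X v) ≤ s)
    (hout : ∀ X w, Mailbox.partners (fun v => B X v w) ≤ k)
    (hin : ∀ X v, Mailbox.partners (B X v) ≤ k) :
    Reachable hs hq k (T + 1) B := by
  classical
  obtain ⟨step, hmem, hcap, hA⟩ := h
  have hst : ∃ st : Fin q → Mailbox p q → Mailbox p q, ∀ X w v, st w (A X w) v = B X v w := by
    -- The machine guesses any input compatible with its memory; by `hloc` the choice is irrelevant.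
    -- Memories that never occur send nothing.
    refine ⟨fun w m => if h : ∃ X, A X w = m then fun v => B h.choose v w else fun _ => [], ?_⟩
    intro X w v
    have h : ∃ Y, A Y w = A X w := ⟨X, rfl⟩
    simp only [dif_pos h]
    exact hloc _ _ _ h.choose_spec v
  obtain ⟨st, hst⟩ := hst
  let step' : Fin (T + 1) → Fin q → Mailbox p q → Mailbox p q := fun t =>
    if h : t.1 < T then step ⟨t, h⟩ else st
  have hm : ∀ X t, t ≤ T → (Protocol.mk q s hs hq step').memory X t =
      (Protocol.mk q s hs hq step).memory X t := fun X t ht =>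
    Protocol.memory_congr hs hq step' step t (by omega) ht
      (fun u hu => by simp [step', show u < T by omega]) X
  have hsend : ∀ X (t : Fin (T + 1)) i, (∃ u : Fin T, (Protocol.mk q s hs hq step').sent X t i =
      (Protocol.mk q s hs hq step).sent X u i ∧ (Protocol.mk q s hs hq step').received X t i =
      (Protocol.mk q s hs hq step).received X u i) ∨
      ((Protocol.mk q s hs hq step').sent X t i = (fun v => B X v i) ∧
        (Protocol.mk q s hs hq step').received X t i = B X i) := by
    intro X t i
    by_cases ht : t.1 < T
    · left
      refine ⟨⟨t, ht⟩, ?_⟩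
      constructor
      · simp only [Protocol.sent, hm X t ht.le, step', ht, dite_true]
      · funext j
        simp only [Protocol.received, Protocol.sent, hm X t ht.le, step', ht, dite_true]
    · right
      have hT : t.1 = T := by omega
      constructor
      · funext v
        simp only [Protocol.sent, hT, hm X T le_rfl, hA, step', lt_irrefl, dite_false]
        exact hst X i v
      · funext j
        simp only [Protocol.received, Protocol.sent, hT, hm X T le_rfl, hA, step', lt_irrefl,
          dite_false]
        exact hst X j i
  refine ⟨step', fun X t i => ?_, fun X t i => ?_, fun X => ?_⟩
  · rcases hsend X t i with ⟨u, h1, h2⟩ | ⟨h1, h2⟩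
    · rw [h1, h2]; exact hmem X u i
    · rw [h1, h2]; exact ⟨hsent X i, hrecv X i⟩
  · rcases hsend X t i with ⟨u, h1, h2⟩ | ⟨h1, h2⟩
    · rw [h1, h2]; exact hcap X u i
    · rw [h1, h2]; exact ⟨hout X i, hin X i⟩
  · funext i j
    simp only [Protocol.memory, Nat.lt_succ_self, dite_true, hm X T le_rfl, hA, step',
      lt_irrefl, dite_false]
    exact hst X j i

end Reachability

/-! ### Sets of packets as memory contents. -/

section Packets

/-- An injective encoding of the elements of a small finite type by `c` words each extends to
finite sets. -/
theorem exists_finset_encoding {P : Type*} [Fintype P] {p c : ℕ} (hc : 0 < c)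
    (h : Fintype.card P ≤ (2 ^ p) ^ c) :
    ∃ E : Finset P → List (Word p), Function.Injective E ∧ ∀ S, (E S).length = c * S.card := by
  classical
  have hcard : Fintype.card P ≤ Fintype.card (Fin c → Word p) := by
    simpa [ZMod.card] using h
  obtain ⟨e⟩ := Function.Embedding.nonempty_of_card_le hcard
  have hlen : ∀ l : List P, (l.flatMap fun x => List.ofFn (e x)).length = c * l.length := by
    intro l
    simp [List.length_flatMap, mul_comm]
  have hinj : ∀ l l' : List P, (l.flatMap fun x => List.ofFn (e x)) =
      (l'.flatMap fun x => List.ofFn (e x)) → l = l' := by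
    intro l
    induction l with
    | nil =>
      intro l' h
      have := congrArg List.length h
      rw [hlen, hlen] at this
      simp at this
      rcases this with h | h
      · omega
      · exact h.symm
    | cons a l ih =>
      intro l' h
      cases l' with
      | nil =>
        have := congrArg List.length h
        rw [hlen, hlen] at this
        simp at this
        omega
      | cons b l' =>
        simp only [List.flatMap_cons] at h
        -- All blocks have the same length `c`, so the first blocks can be compared.
        obtain ⟨h1, h2⟩ := List.append_inj h (by simp)
        rw [ih l' h2, e.injective (List.ofFn_injective h1)]
  refine ⟨fun S => S.toList.flatMap fun x => List.ofFn (e x), fun S S' h => ?_, fun S => ?_⟩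
  · rw [← Finset.toList_toFinset S, ← Finset.toList_toFinset S', hinj _ _ h]
  · rw [hlen, Finset.length_toList]

variable {n p q s : ℕ} {P : Type*}

/-- The packets of `F` that are located at `v`. -/
def packetsAt {V : Type*} [DecidableEq V] (F : Finset P) (loc : P → V) (v : V) : Finset P :=
  F.filter fun x => loc x = v

/-- After `T` rounds the machines can hold the packets in `F`, at the locations `loc`. -/
def PacketReachable (hs : 0 < s) (hq : n ⌈/⌉ s ≤ q) (k : ℕ) (E : Finset P → List (Word p)) (T : ℕ)
    (F : (Fin n → Word p) → Finset P) (loc : (Fin n → Word p) → P → Fin q) : Prop :=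
  ∃ prev : (Fin n → Word p) → P → Fin q, Reachable hs hq k T fun X v w =>
    E ((F X).filter fun x => loc X x = v ∧ prev X x = w)

variable {hs : 0 < s} {hq : n ⌈/⌉ s ≤ q} {k c T : ℕ} {E : Finset P → List (Word p)}
  {F F' : (Fin n → Word p) → Finset P} {loc loc' prev : (Fin n → Word p) → P → Fin q}
  {A : (Fin n → Word p) → Fin q → Mailbox p q}

/-- The packets at `v` are the union of its messages over all senders. The previous locations may
depend on the input, so they are eliminated: locality only has to be checked in terms of the packets
held. -/
theorem packetsAt_eq_of_encoding_eq (hE : Function.Injective E) {X Y : Fin n → Word p} {v : Fin q}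
    (h : (fun w => E ((F X).filter fun x => loc X x = v ∧ prev X x = w)) =
      fun w => E ((F Y).filter fun x => loc Y x = v ∧ prev Y x = w)) :
    packetsAt (F X) (loc X) v = packetsAt (F Y) (loc Y) v := by
  ext x
  have h' : ∀ w, (x ∈ F X ∧ loc X x = v ∧ prev X x = w) ↔
      (x ∈ F Y ∧ loc Y x = v ∧ prev Y x = w) := fun w => by
    have := Finset.ext_iff.1 (hE (congrFun h w)) x
    simpa only [Finset.mem_filter] using this
  have h1 := h' (prev X x)
  have h2 := h' (prev Y x)
  simp only [packetsAt, Finset.mem_filter]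
  tauto

theorem encoding_eq_nil_iff (hc : 0 < c) (hlen : ∀ S, (E S).length = c * S.card) (S : Finset P) :
    E S = [] ↔ S = ∅ := by
  rw [← List.length_eq_zero_iff, hlen, Nat.mul_eq_zero, Finset.card_eq_zero]
  simp [hc.ne']

theorem size_encoding (hlen : ∀ S, (E S).length = c * S.card) (S : Finset P) (g : P → Fin q) :
    Mailbox.size (fun v => E (S.filter fun x => g x = v)) = c * S.card := by
  classical
  simp only [Mailbox.size, hlen, ← Finset.mul_sum]
  rw [Finset.card_eq_sum_card_fiberwise (f := g) (t := Finset.univ) (by simp)]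

theorem partners_encoding (hc : 0 < c) (hlen : ∀ S, (E S).length = c * S.card) (S : Finset P)
    (g : P → Fin q) :
    Mailbox.partners (fun v => E (S.filter fun x => g x = v)) = (S.image g).card := by
  classical
  unfold Mailbox.partners
  congr 1
  ext v
  simp [encoding_eq_nil_iff hc hlen, Finset.filter_eq_empty_iff]

/-- One round that moves the packets to new locations, which depend only on the packets held by the
same machine. -/
theorem PacketReachable.move (hc : 0 < c) (hE : Function.Injective E)
    (hlen : ∀ S, (E S).length = c * S.card) (h : PacketReachable hs hq k E T F loc)
    (hloc : ∀ X Y w, packetsAt (F X) (loc X) w = packetsAt (F Y) (loc Y) w →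
      ∀ x ∈ packetsAt (F X) (loc X) w, loc' X x = loc' Y x)
    (hload : ∀ X w, c * (packetsAt (F X) (loc X) w).card ≤ s)
    (hload' : ∀ X w, c * (packetsAt (F X) (loc' X) w).card ≤ s)
    (hout : ∀ X w, ((packetsAt (F X) (loc X) w).image (loc' X)).card ≤ k)
    (hin : ∀ X w, ((packetsAt (F X) (loc' X) w).image (loc X)).card ≤ k) :
    PacketReachable hs hq k E (T + 1) F loc' := by
  classical
  obtain ⟨prev, h⟩ := h
  have e1 : ∀ X w v, ((F X).filter fun x => loc' X x = v ∧ loc X x = w) =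
      (packetsAt (F X) (loc X) w).filter fun x => loc' X x = v := by
    intro X w v; ext x; simp [packetsAt]; tauto
  have e2 : ∀ X w v, ((F X).filter fun x => loc' X x = v ∧ loc X x = w) =
      (packetsAt (F X) (loc' X) v).filter fun x => loc X x = w := by
    intro X w v; ext x; simp [packetsAt]; tauto
  refine ⟨loc, h.succ ?_ ?_ ?_ ?_ ?_⟩
  · intro X Y w hXY v
    have hp := packetsAt_eq_of_encoding_eq hE hXY
    simp only [e1]
    congr 1
    rw [← hp]
    exact Finset.filter_congr fun x hx => by rw [hloc X Y w hp x hx]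
  · intro X w
    simp only [e1, size_encoding hlen]
    exact hload X w
  · intro X v
    simp only [e2]
    exact (size_encoding hlen _ _).trans_le (hload' X v)
  · intro X w
    simp only [e1]
    exact (partners_encoding hc hlen _ _).trans_le (hout X w)
  · intro X v
    simp only [e2]
    exact (partners_encoding hc hlen _ _).trans_le (hin X v)

/-- One round of local computation that creates packets. -/
theorem Reachable.create (hc : 0 < c) (hlen : ∀ S, (E S).length = c * S.card) (hk : 1 ≤ k)
    (h : Reachable hs hq k T A)
    (hloc : ∀ X Y w, A X w = A Y w →
      packetsAt (F X) (loc X) w = packetsAt (F Y) (loc Y) w)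
    (hload : ∀ X w, c * (packetsAt (F X) (loc X) w).card ≤ s) :
    PacketReachable hs hq k E (T + 1) F loc := by
  classical
  have e1 : ∀ X w v, ((F X).filter fun x => loc X x = v ∧ loc X x = w) =
      (packetsAt (F X) (loc X) w).filter fun x => w = v := by
    intro X w v; ext x; simp [packetsAt]; grind
  have e2 : ∀ X w v, ((F X).filter fun x => loc X x = v ∧ loc X x = w) =
      (packetsAt (F X) (loc X) v).filter fun x => v = w := by
    intro X w v; ext x; simp [packetsAt]; grind
  have hcard : ∀ (S : Finset P) (v : Fin q), (S.image fun _ => v).card ≤ k := fun S v =>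
    (Finset.card_le_card (t := {v}) fun x hx => by simp at hx ⊢; exact hx.2.symm).trans (by simpa)
  refine ⟨loc, h.succ ?_ ?_ ?_ ?_ ?_⟩
  · intro X Y w hXY v
    simp only [e1, hloc X Y w hXY]
  · intro X w
    simp only [e1]
    exact (size_encoding hlen _ _).trans_le (hload X w)
  · intro X v
    simp only [e2]
    exact (size_encoding hlen _ _).trans_le (hload X v)
  · intro X w
    simp only [e1]
    exact (partners_encoding hc hlen _ _).trans_le (hcard _ _)
  · intro X v
    simp only [e2]
    exact (partners_encoding hc hlen _ _).trans_le (hcard _ _)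

theorem PacketReachable.create (hc : 0 < c) (hE : Function.Injective E)
    (hlen : ∀ S, (E S).length = c * S.card) (hk : 1 ≤ k) (h : PacketReachable hs hq k E T F loc)
    (hloc : ∀ X Y w, packetsAt (F X) (loc X) w = packetsAt (F Y) (loc Y) w →
      packetsAt (F' X) (loc' X) w = packetsAt (F' Y) (loc' Y) w)
    (hload : ∀ X w, c * (packetsAt (F' X) (loc' X) w).card ≤ s) :
    PacketReachable hs hq k E (T + 1) F' loc' := by
  obtain ⟨prev, h⟩ := h
  exact Reachable.create hc hlen hk h
    (fun X Y w hXY => hloc X Y w (packetsAt_eq_of_encoding_eq hE hXY)) hload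

end Packets

/-! ### Load bounds for deterministic routing in a grid. -/

section Routing

/-- Every finite set can be dealt evenly to `k` recipients. -/
theorem exists_even_deal {P : Type*} (k : ℕ) (hk : 0 < k) (S : Finset P) :
    ∃ g : P → Fin k, ∀ b, k * (S.filter fun x => g x = b).card ≤ S.card + k := by
  classical
  let e := S.equivFin
  -- Number the elements of `S` and deal by the residue modulo `k`.
  refine ⟨fun x => if h : x ∈ S then ⟨e ⟨x, h⟩ % k, Nat.mod_lt _ hk⟩ else ⟨0, hk⟩, fun b => ?_⟩
  have h1 : (S.filter fun x => (if h : x ∈ S then (⟨e ⟨x, h⟩ % k, Nat.mod_lt _ hk⟩ : Fin k)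
      else ⟨0, hk⟩) = b).card ≤ ((Finset.range S.card).filter fun i => i ≡ b [MOD k]).card := by
    refine Finset.card_le_card_of_injOn (fun x => if h : x ∈ S then (e ⟨x, h⟩ : ℕ) else 0) ?_ ?_
    · intro x hx
      simp only [Finset.coe_filter, Set.mem_ofPred_eq] at hx
      obtain ⟨hxS, hx⟩ := hx
      rw [dif_pos hxS] at hx
      simp only [hxS, dite_true, Finset.coe_filter, Finset.mem_range, Set.mem_ofPred_eq, Fin.is_lt,
        true_and]
      rw [Nat.ModEq, Nat.mod_eq_of_lt b.2, ← hx]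
    · intro x hx y hy hxy
      simp only [Finset.coe_filter, Set.mem_ofPred_eq] at hx hy
      simp only [hx.1, hy.1, dite_true] at hxy
      have := e.injective (Fin.ext hxy)
      simpa using this
  rw [← Nat.count_eq_card_filter_range, Nat.count_modEq_card _ hk] at h1
  have h2 : S.card / k + (if (b : ℕ) % k < S.card % k then 1 else 0) ≤ S.card / k + 1 := by
    split_ifs <;> omega
  calc k * _ ≤ k * (S.card / k + 1) := Nat.mul_le_mul_left _ (h1.trans h2)
    _ ≤ S.card + k := by rw [mul_add, mul_one]; gcongr; exact Nat.mul_div_le _ _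

/-- A way to deal every finite set evenly to `k` recipients. -/
noncomputable def deal {P : Type*} {k : ℕ} (hk : 0 < k) (S : Finset P) : P → Fin k :=
  (exists_even_deal k hk S).choose

theorem card_deal_le {P : Type*} {k : ℕ} (hk : 0 < k) (S : Finset P) (b : Fin k) :
    k * (S.filter fun x => deal hk S x = b).card ≤ S.card + k :=
  (exists_even_deal k hk S).choose_spec b

variable {P : Type*} {d k : ℕ}

/-- The packets located at `v` whose destination has the digit `a` in position `j`. -/
def classAt (F : Finset P) (dest loc : P → Fin d → Fin k) (j : Fin d) (v : Fin d → Fin k)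
    (a : Fin k) : Finset P :=
  (packetsAt F loc v).filter fun x => dest x j = a

/-- The locations after all machines dealt each class of packets, given by the `j`-th digit of the
destination, evenly to the machines that differ from themselves only in the `i`-th digit. -/
noncomputable def balance (hk : 0 < k) (F : Finset P) (dest loc : P → Fin d → Fin k)
    (j i : Fin d) (x : P) : Fin d → Fin k :=
  Function.update (loc x) i (deal hk (classAt F dest loc j (loc x) (dest x j)) x)

/-- Each of the `k` machines on the line contributes a `k`-th of its class plus at most one packet;
multiplied by `k`, the rounding errors sum to `k * k`. -/
theorem card_classAt_balance_le (hk : 0 < k) (F : Finset P) (dest loc : P → Fin d → Fin k)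
    (j i : Fin d) (v : Fin d → Fin k) (a : Fin k) :
    k * (classAt F dest (balance hk F dest loc j i) j v a).card ≤
      ∑ b, (classAt F dest loc j (Function.update v i b) a).card + k * k := by
  classical
  have hsub : classAt F dest (balance hk F dest loc j i) j v a ⊆
      Finset.univ.biUnion fun b => (classAt F dest loc j (Function.update v i b) a).filter fun x =>
        deal hk (classAt F dest loc j (Function.update v i b) a) x = v i := by
    intro x hx
    simp only [classAt, packetsAt, Finset.mem_filter] at hx
    obtain ⟨⟨hxF, hx⟩, hxa⟩ := hx
    have hloc : loc x = Function.update v i (loc x i) := by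
      rw [← hx, balance]; simp
    have hv : deal hk (classAt F dest loc j (loc x) (dest x j)) x = v i := by
      rw [← hx, balance]; simp
    rw [hxa] at hv
    simp only [Finset.mem_biUnion, Finset.mem_univ, true_and, Finset.mem_filter]
    refine ⟨loc x i, ?_, ?_⟩
    · simp only [classAt, packetsAt, Finset.mem_filter]
      exact ⟨⟨hxF, hloc⟩, hxa⟩
    · rw [← hloc]; exact hv
  calc _ ≤ k * ∑ b, ((classAt F dest loc j (Function.update v i b) a).filter fun x =>
        deal hk (classAt F dest loc j (Function.update v i b) a) x = v i).card :=
        Nat.mul_le_mul_left _ ((Finset.card_le_card hsub).trans Finset.card_biUnion_le)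
    _ ≤ ∑ b, ((classAt F dest loc j (Function.update v i b) a).card + k) := by
        rw [Finset.mul_sum]
        exact Finset.sum_le_sum fun b _ => card_deal_le hk _ _
    _ = _ := by simp [Finset.sum_add_distrib]

/-- The packets of a class whose original location agrees with `v` outside of `I`. -/
def classNear (F : Finset P) (dest loc : P → Fin d → Fin k) (j : Fin d) (I : Finset (Fin d))
    (v : Fin d → Fin k) (a : Fin k) : Finset P :=
  F.filter fun x => dest x j = a ∧ ∀ i ∉ I, loc x i = v i

theorem sum_card_classNear (F : Finset P) (dest loc : P → Fin d → Fin k) (j : Fin d)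
    {I : Finset (Fin d)} {i : Fin d} (hi : i ∉ I) (v : Fin d → Fin k) (a : Fin k) :
    ∑ b, (classNear F dest loc j I (Function.update v i b) a).card =
      (classNear F dest loc j (insert i I) v a).card := by
  classical
  rw [Finset.card_eq_sum_card_fiberwise (f := fun x => loc x i) (t := Finset.univ) (by simp)]
  refine Finset.sum_congr rfl fun b _ => congrArg _ ?_
  ext x
  simp only [classNear, Finset.mem_filter, Finset.mem_insert, not_or, and_assoc]
  refine and_congr_right fun _ => and_congr_right fun _ => ⟨fun h => ⟨fun i' hi' => ?_, ?_⟩,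
    fun h i' hi' => ?_⟩
  · simpa [hi'.1] using h i' hi'.2
  · simpa using h i hi
  · by_cases hii : i' = i
    · subst hii; simpa using h.2
    · simpa [hii] using h.1 i' ⟨hii, hi'⟩

/-- The classes of packets are evenly distributed along the directions in `I`. -/
def Balanced (F : Finset P) (dest loc₀ loc : P → Fin d → Fin k) (j : Fin d)
    (I : Finset (Fin d)) : Prop :=
  (∀ x, ∀ i ∉ I, loc x i = loc₀ x i) ∧
    ∀ v a, k ^ I.card * (classAt F dest loc j v a).card ≤
      (classNear F dest loc₀ j I v a).card + I.card * k ^ (I.card + 1)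

theorem balanced_empty (F : Finset P) (dest loc : P → Fin d → Fin k) (j : Fin d) :
    Balanced F dest loc loc j ∅ := by
  refine ⟨fun _ _ _ => rfl, fun v a => ?_⟩
  simp only [Finset.card_empty, pow_zero, one_mul, zero_mul, add_zero]
  refine Finset.card_le_card fun x hx => ?_
  simp only [classAt, classNear, packetsAt, Finset.mem_filter] at hx ⊢
  exact ⟨hx.1.1, hx.2, fun i _ => by rw [hx.1.2]⟩

/-- `Balanced` says, with denominators cleared, that a class at `v` exceeds its original average
over the subgrid through `v` in the directions `I` by at most `I.card * k`. Averaging along one more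
direction enlarges the subgrid and adds an error of `k`. -/
theorem Balanced.insert {F : Finset P} {dest loc₀ loc : P → Fin d → Fin k} {j : Fin d}
    {I : Finset (Fin d)} (h : Balanced F dest loc₀ loc j I) (hk : 0 < k) {i : Fin d}
    (hi : i ∉ I) : Balanced F dest loc₀ (balance hk F dest loc j i) j (insert i I) := by
  refine ⟨fun x i' hi' => ?_, fun v a => ?_⟩
  · simp only [Finset.mem_insert, not_or] at hi'
    rw [balance, Function.update_of_ne hi'.1, h.1 x i' hi'.2]
  · rw [Finset.card_insert_of_notMem hi]
    calc k ^ (I.card + 1) * (classAt F dest (balance hk F dest loc j i) j v a).card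
        = k ^ I.card * (k * (classAt F dest (balance hk F dest loc j i) j v a).card) := by ring
      _ ≤ k ^ I.card * (∑ b, (classAt F dest loc j (Function.update v i b) a).card + k * k) :=
          Nat.mul_le_mul_left _ (card_classAt_balance_le hk F dest loc j i v a)
      _ = ∑ b, k ^ I.card * (classAt F dest loc j (Function.update v i b) a).card +
            k ^ (I.card + 2) := by rw [mul_add, Finset.mul_sum]; ring
      _ ≤ ∑ b, ((classNear F dest loc₀ j I (Function.update v i b) a).card +
            I.card * k ^ (I.card + 1)) + k ^ (I.card + 2) := by
          gcongr with b
          exact h.2 _ _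
      _ = _ := by
          rw [Finset.sum_add_distrib, sum_card_classNear F dest loc₀ j hi]
          simp only [Finset.sum_const, Finset.card_univ, Fintype.card_fin, smul_eq_mul]
          ring

theorem sum_card_classAt (F : Finset P) (dest loc : P → Fin d → Fin k) (j : Fin d)
    (v : Fin d → Fin k) :
    ∑ a, (classAt F dest loc j v a).card = (packetsAt F loc v).card :=
  (Finset.card_eq_sum_card_fiberwise (by simp)).symm

theorem card_near_le (F : Finset P) (loc : P → Fin d → Fin k) (I : Finset (Fin d))
    (v : Fin d → Fin k) {N : ℕ} (hN : ∀ w, (packetsAt F loc w).card ≤ N) :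
    (F.filter fun x => ∀ i ∉ I, loc x i = v i).card ≤ k ^ I.card * N := by
  classical
  have hmaps : ∀ x ∈ F.filter fun x => ∀ i ∉ I, loc x i = v i,
      loc x ∈ (Finset.univ.image fun (u : I → Fin k) i => if h : i ∈ I then u ⟨i, h⟩ else v i) := by
    intro x hx
    simp only [Finset.mem_filter] at hx
    simp only [Finset.mem_image, Finset.mem_univ, true_and]
    refine ⟨fun i => loc x i, ?_⟩
    funext i
    by_cases hi : i ∈ I
    · simp [hi]
    · simp [hi, hx.2 i hi]
  rw [Finset.card_eq_sum_card_fiberwise hmaps]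
  calc _ ≤ ∑ w ∈ (Finset.univ.image fun (u : I → Fin k) i =>
        if h : i ∈ I then u ⟨i, h⟩ else v i), N := by
        refine Finset.sum_le_sum fun w _ => (Finset.card_le_card ?_).trans (hN w)
        intro x hx
        simp only [packetsAt, Finset.mem_filter] at hx ⊢
        exact ⟨hx.1.1, hx.2⟩
    _ ≤ k ^ I.card * N := by
        rw [Finset.sum_const, smul_eq_mul]
        refine Nat.mul_le_mul_right _ (Finset.card_image_le.trans ?_)
        simp

/-- Summing over the `k` classes turns the error of at most `d * k` per class into `d * k ^ 2`. This
controls the memory during the deals. -/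
theorem Balanced.card_packetsAt_le {F : Finset P} {dest loc₀ loc : P → Fin d → Fin k} {j : Fin d}
    {I : Finset (Fin d)} (h : Balanced F dest loc₀ loc j I) (hk : 0 < k) {N : ℕ}
    (hN : ∀ w, (packetsAt F loc₀ w).card ≤ N) (v : Fin d → Fin k) :
    (packetsAt F loc v).card ≤ N + d * k ^ 2 := by
  have hI : I.card ≤ d := by simpa using Finset.card_le_univ I
  have hsum : ∑ a, (classNear F dest loc₀ j I v a).card =
      (F.filter fun x => ∀ i ∉ I, loc₀ x i = v i).card := by
    rw [Finset.card_eq_sum_card_fiberwise (f := fun x => dest x j) (t := Finset.univ) (by simp)]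
    refine Finset.sum_congr rfl fun b _ => congrArg _ ?_
    ext x
    simp only [classNear, Finset.mem_filter]
    tauto
  refine Nat.le_of_mul_le_mul_left ?_ (pow_pos hk I.card)
  calc k ^ I.card * (packetsAt F loc v).card
      = ∑ a, k ^ I.card * (classAt F dest loc j v a).card := by
        rw [← sum_card_classAt F dest loc j, Finset.mul_sum]
    _ ≤ ∑ a, ((classNear F dest loc₀ j I v a).card + I.card * k ^ (I.card + 1)) :=
        Finset.sum_le_sum fun a _ => h.2 v a
    _ = (F.filter fun x => ∀ i ∉ I, loc₀ x i = v i).card + I.card * (k ^ I.card * k ^ 2) := by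
        rw [Finset.sum_add_distrib, hsum]
        simp only [Finset.sum_const, Finset.card_univ, Fintype.card_fin, smul_eq_mul]
        ring
    _ ≤ k ^ I.card * N + d * (k ^ I.card * k ^ 2) := by
        gcongr
        exact card_near_le F loc₀ I v hN
    _ = _ := by ring

/-- The locations after the `j`-th digits have been corrected. -/
def correct (dest loc : P → Fin d → Fin k) (j : Fin d) (x : P) : Fin d → Fin k :=
  Function.update (loc x) j (dest x j)

/-- Arrivals at `v` come from the class `v j` of the machines on its `j`-line. The packets counted
by the averages started in agreement with `v` on the digits before `j`, which are already correct,
and have destination digit `v j`. So their destinations agree with `v` up to digit `j`, and at most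
`k ^ I.card * M` packets qualify. -/
theorem Balanced.card_packetsAt_correct_le {F : Finset P} {dest loc₀ loc : P → Fin d → Fin k}
    {j : Fin d} (h : Balanced F dest loc₀ loc j (Finset.Ioi j)) (hk : 0 < k) {M : ℕ}
    (hM : ∀ w, (packetsAt F dest w).card ≤ M) (hloc : ∀ x, ∀ i < j, loc₀ x i = dest x i)
    (v : Fin d → Fin k) :
    (packetsAt F (correct dest loc j) v).card ≤ M + d * k ^ 2 := by
  classical
  have hI : (Finset.Ioi j).card ≤ d := by simpa using Finset.card_le_univ (Finset.Ioi j)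
  set I := Finset.Ioi j
  have hj : j ∉ I := by simp [I]
  have hsub : packetsAt F (correct dest loc j) v ⊆
      Finset.univ.biUnion fun b => classAt F dest loc j (Function.update v j b) (v j) := by
    intro x hx
    simp only [packetsAt, Finset.mem_filter] at hx
    simp only [Finset.mem_biUnion, Finset.mem_univ, true_and, classAt, packetsAt, Finset.mem_filter]
    refine ⟨loc x j, ⟨hx.1, ?_⟩, ?_⟩
    · rw [← hx.2, correct]; simp
    · rw [← hx.2, correct]; simp
  have hnear : classNear F dest loc₀ j (Insert.insert j I) v (v j) ⊆
      F.filter fun x => ∀ i ∉ I, dest x i = v i := by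
    intro x hx
    simp only [classNear, Finset.mem_filter, Finset.mem_insert, not_or] at hx ⊢
    refine ⟨hx.1, fun i hi => ?_⟩
    by_cases hij : i = j
    · rw [hij]; exact hx.2.1
    · have hlt : i < j := by simp [I] at hi; exact lt_of_le_of_ne hi hij
      rw [← hloc x i hlt]
      exact hx.2.2 i ⟨hij, hi⟩
  refine Nat.le_of_mul_le_mul_left ?_ (pow_pos hk I.card)
  calc k ^ I.card * (packetsAt F (correct dest loc j) v).card
      ≤ k ^ I.card * ∑ b, (classAt F dest loc j (Function.update v j b) (v j)).card :=
        Nat.mul_le_mul_left _ ((Finset.card_le_card hsub).trans Finset.card_biUnion_le)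
    _ ≤ ∑ b, ((classNear F dest loc₀ j I (Function.update v j b) (v j)).card +
          I.card * k ^ (I.card + 1)) := by
        rw [Finset.mul_sum]
        exact Finset.sum_le_sum fun b _ => h.2 _ _
    _ = (classNear F dest loc₀ j (Insert.insert j I) v (v j)).card +
          I.card * (k ^ I.card * k ^ 2) := by
        rw [Finset.sum_add_distrib, sum_card_classNear F dest loc₀ j hj]
        simp only [Finset.sum_const, Finset.card_univ, Fintype.card_fin, smul_eq_mul]
        ring
    _ ≤ k ^ I.card * M + d * (k ^ I.card * k ^ 2) := by
        gcongr
        exact (Finset.card_le_card hnear).trans (card_near_le F dest I v hM)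
    _ = _ := by ring

end Routing

/-! ### The routing as rounds of a protocol. -/

section RoutingRounds

variable {n p q s : ℕ} {P : Type*} {hs : 0 < s} {hq : n ⌈/⌉ s ≤ q} {cap c T d k M : ℕ}
  {E : Finset P → List (Word p)} {F : (Fin n → Word p) → Finset P}

theorem packetsAt_equiv {V : Type*} [DecidableEq V] (e : Fin q ≃ V) (S : Finset P) (loc : P → V)
    (w : Fin q) : packetsAt S (fun x => e.symm (loc x)) w = packetsAt S loc (e w) := by
  ext x; simp [packetsAt, Equiv.symm_apply_eq]

theorem card_image_packetsAt_le (e : Fin q ≃ (Fin d → Fin k)) (S : Finset P)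
    (loc loc' : P → Fin d → Fin k) (i : Fin d) (h : ∀ x, ∀ i' ≠ i, loc' x i' = loc x i')
    (w : Fin q) :
    ((packetsAt S (fun x => e.symm (loc x)) w).image fun x => e.symm (loc' x)).card ≤ k := by
  classical
  calc _ ≤ (Finset.univ.image fun b : Fin k => e.symm (Function.update (e w) i b)).card := by
        refine Finset.card_le_card fun v hv => ?_
        simp only [packetsAt, Finset.mem_image, Finset.mem_filter] at hv
        obtain ⟨x, ⟨-, hx⟩, rfl⟩ := hv
        simp only [Finset.mem_image, Finset.mem_univ, true_and]
        refine ⟨loc' x i, ?_⟩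
        rw [← hx]
        congr 1
        funext i'
        by_cases hi : i' = i
        · subst hi; simp
        · simp [hi, h x i' hi]
    _ ≤ k := Finset.card_image_le.trans (by simp)

/-- One round that moves packets along the `i`-th direction of the grid of machines. -/
theorem PacketReachable.moveAlong (hc : 0 < c) (hE : Function.Injective E)
    (hlen : ∀ S, (E S).length = c * S.card) (hcap : k ≤ cap) (e : Fin q ≃ (Fin d → Fin k))
    {loc loc' : (Fin n → Word p) → P → Fin d → Fin k} (i : Fin d)
    (h : PacketReachable hs hq cap E T F fun X x => e.symm (loc X x))
    (hi : ∀ X x, ∀ i' ≠ i, loc' X x i' = loc X x i')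
    (hloc : ∀ X Y v, packetsAt (F X) (loc X) v = packetsAt (F Y) (loc Y) v →
      ∀ x ∈ packetsAt (F X) (loc X) v, loc' X x = loc' Y x)
    (hload : ∀ X v, c * (packetsAt (F X) (loc X) v).card ≤ s)
    (hload' : ∀ X v, c * (packetsAt (F X) (loc' X) v).card ≤ s) :
    PacketReachable hs hq cap E (T + 1) F fun X x => e.symm (loc' X x) := by
  refine h.move hc hE hlen ?_ ?_ ?_ ?_ ?_
  · intro X Y w hXY x hx
    rw [packetsAt_equiv, packetsAt_equiv] at hXY
    rw [packetsAt_equiv] at hx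
    rw [hloc X Y _ hXY x hx]
  · intro X w
    rw [packetsAt_equiv]
    exact hload X _
  · intro X w
    rw [packetsAt_equiv]
    exact hload' X _
  · intro X w
    exact (card_image_packetsAt_le e _ _ _ i (hi X) w).trans hcap
  · intro X w
    exact (card_image_packetsAt_le e _ _ _ i (fun x i' hi' => (hi X x i' hi').symm) w).trans hcap

/-- The rounds that correct the `j`-th digits. -/
theorem PacketReachable.stage (hc : 0 < c) (hE : Function.Injective E)
    (hlen : ∀ S, (E S).length = c * S.card) (hk : 0 < k) (hcap : k ≤ cap)
    (e : Fin q ≃ (Fin d → Fin k)) (hs' : c * (M + 2 * (d * k ^ 2)) ≤ s)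
    {dest : P → Fin d → Fin k} {loc : (Fin n → Word p) → P → Fin d → Fin k}
    (hM : ∀ X v, (packetsAt (F X) dest v).card ≤ M) (j : Fin d)
    (h : PacketReachable hs hq cap E T F fun X x => e.symm (loc X x))
    (hloc : ∀ X x, ∀ i < j, loc X x i = dest x i)
    (hload : ∀ X v, (packetsAt (F X) (loc X) v).card ≤ M + d * k ^ 2) :
    ∃ loc' : (Fin n → Word p) → P → Fin d → Fin k,
      PacketReachable hs hq cap E (T + (d - j)) F (fun X x => e.symm (loc' X x)) ∧
      (∀ X x, ∀ i ≤ j, loc' X x i = dest x i) ∧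
      ∀ X v, (packetsAt (F X) (loc' X) v).card ≤ M + d * k ^ 2 := by
  classical
  have hbal : ∀ loc' : (Fin n → Word p) → P → Fin d → Fin k, ∀ I : Finset (Fin d),
      (∀ X, Balanced (F X) dest (loc X) (loc' X) j I) →
      ∀ X v, c * (packetsAt (F X) (loc' X) v).card ≤ s := by
    intro loc' I hI X v
    refine le_trans (Nat.mul_le_mul_left _ ((hI X).card_packetsAt_le hk (hload X) v)) ?_
    -- One `d * k ^ 2` is inherited from the previous stage, the other is the error of the current
    -- deals.
    rwa [add_assoc, ← two_mul]
  have key : ∀ I : Finset (Fin d), ∃ loc' : (Fin n → Word p) → P → Fin d → Fin k,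
      PacketReachable hs hq cap E (T + I.card) F (fun X x => e.symm (loc' X x)) ∧
      ∀ X, Balanced (F X) dest (loc X) (loc' X) j I := by
    intro I
    induction I using Finset.induction_on with
    | empty => exact ⟨loc, h, fun X => balanced_empty _ _ _ _⟩
    | insert i I hi ih =>
      obtain ⟨loc', h1, h2⟩ := ih
      have h3 : ∀ X, Balanced (F X) dest (loc X) (balance hk (F X) dest (loc' X) j i) j
          (insert i I) := fun X => (h2 X).insert hk hi
      refine ⟨fun X => balance hk (F X) dest (loc' X) j i, ?_, h3⟩
      rw [Finset.card_insert_of_notMem hi, ← add_assoc]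
      refine h1.moveAlong hc hE hlen hcap e i (fun X x i' hi' => ?_) ?_ (hbal _ _ h2) (hbal _ _ h3)
      · simp [balance, hi']
      -- A deal depends only on the class as a set, so a machine can compute it from its own
      -- packets.
      · intro X Y v hXY x hx
        have hx' := hx
        rw [hXY] at hx'
        simp only [packetsAt, Finset.mem_filter] at hx hx'
        simp only [balance, hx.2, hx'.2, classAt, hXY]
  obtain ⟨loc', h1, h2⟩ := key (Finset.Ioi j)
  have h3 : ∀ X v, (packetsAt (F X) (correct dest (loc' X) j) v).card ≤ M + d * k ^ 2 :=
    fun X v => (h2 X).card_packetsAt_correct_le hk (hM X) (hloc X) v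
  refine ⟨fun X => correct dest (loc' X) j, ?_, ?_, h3⟩
  -- There are `d - 1 - j` rounds of dealing and one round of correction.
  · have hT : T + (d - j) = T + (Finset.Ioi j).card + 1 := by
      rw [Fin.card_Ioi]; omega
    rw [hT]
    refine h1.moveAlong hc hE hlen hcap e j (fun X x i' hi' => ?_) ?_ (hbal _ _ h2) ?_
    · simp [correct, hi']
    · intro X Y v hXY x hx
      have hx' := hx
      rw [hXY] at hx'
      simp only [packetsAt, Finset.mem_filter] at hx hx'
      simp only [correct, hx.2, hx'.2]
    · intro X v
      refine le_trans (Nat.mul_le_mul_left _ ((h3 X v).trans ?_)) hs'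
      omega
  · intro X x i hi
    change correct dest (loc' X) j x i = dest x i
    rcases hi.lt_or_eq with hi | rfl
    · rw [correct, Function.update_of_ne hi.ne, (h2 X).1 x i (by simpa using hi.le), hloc X x i hi]
    · simp [correct]

/-- The number of rounds for routing in a grid of dimension `d`. -/
def routingRounds (d : ℕ) : ℕ := ∑ j ∈ Finset.range d, (d - j)

theorem routingRounds_le (d : ℕ) : routingRounds d ≤ d ^ 2 := by
  calc routingRounds d ≤ ∑ _j ∈ Finset.range d, d := Finset.sum_le_sum fun j _ => Nat.sub_le _ _
    _ = d ^ 2 := by simp [sq]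

/-- Packets can be routed to their destinations when no machine is the source or the destination of
more than `M` packets. -/
theorem PacketReachable.route (hc : 0 < c) (hE : Function.Injective E)
    (hlen : ∀ S, (E S).length = c * S.card) (hk : 0 < k) (hcap : k ≤ cap)
    (e : Fin q ≃ (Fin d → Fin k)) (hs' : c * (M + 2 * (d * k ^ 2)) ≤ s)
    {dest : P → Fin q} {loc : (Fin n → Word p) → P → Fin q}
    (hdest : ∀ X v, (packetsAt (F X) dest v).card ≤ M)
    (hload : ∀ X v, (packetsAt (F X) (loc X) v).card ≤ M)
    (h : PacketReachable hs hq cap E T F loc) :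
    PacketReachable hs hq cap E (T + routingRounds d) F fun _ => dest := by
  have hconv : ∀ (S : Finset P) (l : P → Fin q) (v : Fin d → Fin k),
      packetsAt S (fun x => e (l x)) v = packetsAt S l (e.symm v) := by
    intro S l v; ext x; simp [packetsAt, Equiv.eq_symm_apply]
  have key : ∀ m ≤ d, ∃ loc' : (Fin n → Word p) → P → Fin d → Fin k,
      PacketReachable hs hq cap E (T + ∑ j ∈ Finset.range m, (d - j)) F
        (fun X x => e.symm (loc' X x)) ∧
      (∀ X x, ∀ i : Fin d, i.1 < m → loc' X x i = e (dest x) i) ∧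
      ∀ X v, (packetsAt (F X) (loc' X) v).card ≤ M + d * k ^ 2 := by
    intro m
    induction m with
    | zero =>
      intro _
      refine ⟨fun X x => e (loc X x), by simpa using h, fun _ _ _ h => by omega, fun X v => ?_⟩
      rw [hconv]
      exact (hload X _).trans (Nat.le_add_right _ _)
    | succ m ih =>
      intro hm
      obtain ⟨loc', h1, h2, h3⟩ := ih (by omega)
      obtain ⟨loc'', h4, h5, h6⟩ := h1.stage hc hE hlen hk hcap e hs' (dest := fun x => e (dest x))
        (fun X v => by rw [hconv]; exact hdest X _) ⟨m, hm⟩ (fun X x i hi => h2 X x i hi) h3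
      refine ⟨loc'', ?_, fun X x i hi => h5 X x i (Nat.lt_succ_iff.1 hi), h6⟩
      rw [Finset.sum_range_succ, ← add_assoc]
      exact h4
  obtain ⟨loc', h1, h2, -⟩ := key d le_rfl
  have heq : (fun X x => e.symm (loc' X x)) = fun _ => dest := by
    funext X x
    rw [Equiv.symm_apply_eq]
    funext i
    exact h2 X x i i.2
  rwa [heq] at h1

end RoutingRounds

/-! ### Concatenations over ranges. -/

section Lists

variable {α : Type*}

theorem take_drop_take_drop (l : List α) {a b c m : ℕ} (h : c + m ≤ b) :
    (((l.drop a).take b).drop c).take m = (l.drop (a + c)).take m := by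
  rw [List.drop_take, List.take_take, List.drop_drop, min_eq_left (by omega)]

theorem range_mul_flatMap (a b : ℕ) (G : ℕ → List α) :
    (List.range (a * b)).flatMap G =
      (List.range a).flatMap fun i => (List.range b).flatMap fun r => G (i * b + r) := by
  induction a with
  | zero => simp
  | succ a ih =>
    rw [add_mul, one_mul, List.range_add, List.flatMap_append, ih, List.range_succ,
      List.flatMap_append, List.flatMap_map]
    simp

theorem range_flatMap_eq_of_le {a b : ℕ} (h : a ≤ b) {G : ℕ → List α}
    (hG : ∀ i, a ≤ i → G i = []) : (List.range b).flatMap G = (List.range a).flatMap G := by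
  obtain ⟨c, rfl⟩ := Nat.exists_eq_add_of_le h
  rw [List.range_add, List.flatMap_append, List.flatMap_map]
  simp [hG]

theorem range_flatMap_eq_of_forall_ne {a v : ℕ} (h : v < a) {G : ℕ → List α}
    (hG : ∀ i, i ≠ v → G i = []) : (List.range a).flatMap G = G v := by
  rw [range_flatMap_eq_of_le (Nat.succ_le_of_lt h) fun i hi => hG i (by omega), List.range_succ,
    List.flatMap_append]
  have : (List.range v).flatMap G = [] := by
    rw [List.flatMap_eq_nil_iff]
    intro i hi
    exact hG i (List.mem_range.1 hi).ne
  simp [this]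

theorem finRange_take_flatMap {q N : ℕ} (h : N ≤ q) (G : ℕ → List α) :
    ((List.finRange q).take N).flatMap (fun i : Fin q => G i.val) =
      (List.range N).flatMap G := by
  have : ((List.finRange q).take N).map Fin.val = List.range N := by
    rw [List.map_take, List.map_coe_finRange_eq_range, List.take_range, min_eq_left h]
  rw [← this, List.flatMap_map]

/-- The indices `w` with `w / b = v` form one interval of length `b`; since `G` vanishes from `q`
on, the range may be extended to a multiple of `b`. This puts the gathered output in the correct
order. -/
theorem range_flatMap_ite_div {q b v : ℕ} (hb : 0 < b) {G : ℕ → List α}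
    (hG : ∀ i, q ≤ i → G i = []) :
    (List.range q).flatMap (fun w => if w / b = v then G w else []) =
      (List.range b).flatMap fun r => G (v * b + r) := by
  have h1 : q ≤ (v + 1 + q) * b := (Nat.le_mul_of_pos_right q hb).trans (by gcongr; omega)
  rw [← range_flatMap_eq_of_le h1 (fun i hi => by simp [hG i hi]), range_mul_flatMap,
    range_flatMap_eq_of_forall_ne (v := v) (by omega)]
  · refine List.flatMap_congr fun r hr => ?_
    have hr := List.mem_range.1 hr
    rw [if_pos]
    rw [mul_comm, Nat.mul_add_div hb, Nat.div_eq_of_lt hr, add_zero]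
  · intro i hi
    rw [List.flatMap_eq_nil_iff]
    intro r hr
    have hr := List.mem_range.1 hr
    rw [if_neg]
    rwa [mul_comm, Nat.mul_add_div hb, Nat.div_eq_of_lt hr, add_zero]

end Lists

/-! ### Counting bounds for mailboxes. -/

theorem card_filter_div_le (q v : ℕ) {g : ℕ} (hg : 0 < g) :
    (Finset.univ.filter fun j : Fin q => j.1 / g = v).card ≤ g := by
  calc _ ≤ (Finset.Ico (v * g) (v * g + g)).card := by
        refine Finset.card_le_card_of_injOn Fin.val (fun j hj => ?_) Fin.val_injective.injOn
        simp only [Finset.coe_filter, Finset.mem_univ, true_and, Set.mem_ofPred_eq] at hj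
        rw [Finset.coe_Ico, Set.mem_Ico, ← hj]
        exact ⟨Nat.div_mul_le_self _ _, Nat.lt_div_mul_add hg⟩
    _ = g := by simp

theorem card_filter_val_eq_le (q v : ℕ) :
    (Finset.univ.filter fun j : Fin q => v = j.1).card ≤ 1 := by
  refine Finset.card_le_one.2 fun a ha b hb => ?_
  simp only [Finset.mem_filter, Finset.mem_univ, true_and] at ha hb
  exact Fin.ext (ha.symm.trans hb)

section Mailboxes

variable {p q : ℕ}

theorem Mailbox.size_le {m : Mailbox p q} {S : Finset (Fin q)} {L : ℕ} (h : ∀ j ∉ S, m j = [])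
    (hL : ∀ j, (m j).length ≤ L) : m.size ≤ S.card * L := by
  rw [Mailbox.size, ← Finset.sum_subset (Finset.subset_univ S) fun j _ hj => by simp [h j hj],
    ← smul_eq_mul]
  exact Finset.sum_le_card_nsmul _ _ _ fun j _ => hL j

theorem Mailbox.partners_le {m : Mailbox p q} {S : Finset (Fin q)} (h : ∀ j ∉ S, m j = []) :
    m.partners ≤ S.card := by
  refine Finset.card_le_card fun j hj => ?_
  by_contra hS
  simp only [Finset.mem_filter] at hj
  exact hj.2 (h j hS)

theorem Mailbox.length_concat (m : Mailbox p q) : m.concat.length = m.size := by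
  simp [Mailbox.concat, Mailbox.size, List.length_flatten, List.sum_ofFn]

theorem Mailbox.concat_eq_range_flatMap (m : Mailbox p q) (G : ℕ → List (Word p))
    (h : ∀ j, m j = G j) : m.concat = (List.range q).flatMap G := by
  rw [← finRange_take_flatMap le_rfl G, Mailbox.concat, List.ofFn_eq_map, List.flatMap]
  rw [List.take_of_length_le (by simp)]
  congr 1
  exact List.map_congr_left fun j _ => h j

end Mailboxes

/-! ### Splitting messages into labelled words. -/

section PacketEncoding

/-- A word of a message, labelled by the sender and the recipient of the message and by its position
in the message. -/
abbrev Packet (p q s : ℕ) := Fin q × Fin q × Fin s × Word p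

variable {p q s : ℕ}

/-- The packets in the memories `m`. -/
def packetsOf (s : ℕ) (m : Fin q → Mailbox p q) : Finset (Packet p q s) :=
  Finset.univ.filter fun x => (m x.2.1 x.1)[x.2.2.1.val]? = some x.2.2.2

theorem mem_packetsOf {m : Fin q → Mailbox p q} {x : Packet p q s} :
    x ∈ packetsOf s m ↔ (m x.2.1 x.1)[x.2.2.1.val]? = some x.2.2.2 := by
  simp [packetsOf]

theorem card_packetsOf_to_le (m : Fin q → Mailbox p q) (j : Fin q) :
    ((packetsOf s m).filter fun x => x.2.1 = j).card ≤ (m j).size := by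
  classical
  calc _ ≤ (Finset.univ.sigma fun i => Finset.range (m j i).length).card := by
        refine Finset.card_le_card_of_injOn (fun x => ⟨x.1, x.2.2.1⟩) (fun x hx => ?_)
          fun x hx y hy hxy => ?_
        · simp only [Finset.coe_filter, Set.mem_ofPred_eq, mem_packetsOf] at hx
          obtain ⟨h, rfl⟩ := hx
          simpa using (List.getElem?_eq_some_iff.1 h).1
        · simp only [Finset.coe_filter, Set.mem_ofPred_eq, mem_packetsOf] at hx hy
          obtain ⟨x1, x2, x3, x4⟩ := x
          obtain ⟨y1, y2, y3, y4⟩ := y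
          simp only [Sigma.mk.injEq, heq_eq_eq, Fin.val_inj] at hxy
          obtain ⟨rfl, rfl⟩ := hxy
          simp only at hx hy
          obtain ⟨hx, rfl⟩ := hx
          obtain ⟨hy, rfl⟩ := hy
          rw [hx] at hy
          simpa using hy
    _ = (m j).size := by simp [Mailbox.size]

theorem card_packetsOf_from_le (m : Fin q → Mailbox p q) (i : Fin q) :
    ((packetsOf s m).filter fun x => x.1 = i).card ≤ Mailbox.size fun j => m j i := by
  classical
  calc _ ≤ ((packetsOf s fun i j => m j i).filter fun x => x.2.1 = i).card := by
        refine Finset.card_le_card_of_injOn (fun x => (x.2.1, x.1, x.2.2)) (fun x hx => ?_)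
          fun x hx y hy hxy => ?_
        · simpa only [Finset.coe_filter, Set.mem_ofPred_eq, mem_packetsOf] using hx
        · simp only [Prod.mk.injEq] at hxy
          exact Prod.ext hxy.2.1 (Prod.ext hxy.1 hxy.2.2)
    _ ≤ _ := card_packetsOf_to_le _ i

/-- Packets record only positions below `s`; the size bounds ensure that no word lies beyond them.
-/
theorem eq_of_packetsOf_eq {m m' : Fin q → Mailbox p q} {j : Fin q} (hm : (m j).size ≤ s)
    (hm' : (m' j).size ≤ s)
    (h : ∀ x : Packet p q s, x.2.1 = j → (x ∈ packetsOf s m ↔ x ∈ packetsOf s m')) :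
    m j = m' j := by
  funext i
  have hlen : ∀ b : Mailbox p q, b.size ≤ s → (b i).length ≤ s := fun b hb =>
    (Finset.single_le_sum (f := fun i => (b i).length) (fun _ _ => Nat.zero_le _)
      (Finset.mem_univ i)).trans hb
  refine List.ext_getElem? fun a => ?_
  by_cases ha : a < s
  · refine Option.ext fun w => ?_
    simpa only [mem_packetsOf] using h (i, j, ⟨a, ha⟩, w) rfl
  · rw [List.getElem?_eq_none ((hlen _ hm).trans (not_lt.1 ha)),
      List.getElem?_eq_none ((hlen _ hm').trans (not_lt.1 ha))]

end PacketEncoding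

/-! ### Simulation of a protocol on the grid. -/

section Simulation

variable {n p R : ℕ} {π : Protocol n p R}

theorem Protocol.RespectsMemory.size_memory_le (h : π.RespectsMemory) (X : Fin n → Word p) (t : ℕ)
    (i : Fin π.q) : (π.memory X t i).size ≤ π.s := by
  induction t with
  | zero =>
    have h1 : (π.memory X 0 i).size ≤ ({i} : Finset (Fin π.q)).card * π.s := by
      refine Mailbox.size_le (fun j hj => ?_) fun j => ?_
      · simp only [Finset.mem_singleton] at hj
        simp [Protocol.memory, Protocol.initial, hj]
      · simp only [Protocol.memory, Protocol.initial]
        split_ifs <;> simp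
    simpa using h1
  | succ t ih =>
    by_cases ht : t < R
    · have : π.memory X (t + 1) i = π.received X ⟨t, ht⟩ i := by
        funext j
        simp [Protocol.memory, ht, Protocol.received, Protocol.sent]
      rw [this]
      exact (h X ⟨t, ht⟩ i).2
    · simpa [Protocol.memory, ht] using ih

theorem Protocol.memory_succ (X : Fin n → Word p) {t : ℕ} (ht : t < R) (i j : Fin π.q) :
    π.memory X (t + 1) i j = π.step ⟨t, ht⟩ j (π.memory X t j) i := by
  simp [Protocol.memory, ht]

/-- The machine that simulates machine `j` when each machine simulates `g` machines. -/
def host {q q' : ℕ} (h : q ≤ q') (g : ℕ) (j : Fin q) : Fin q' :=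
  ⟨j / g, (Nat.div_le_self _ _).trans_lt (j.2.trans_le h)⟩

theorem card_packetsAt_host_le {q q' s g : ℕ} (h : q ≤ q') (hg : 0 < g) (S : Finset (Packet p q s))
    (a : Packet p q s → Fin q) (ha : ∀ j, (S.filter fun x => a x = j).card ≤ s) (v : Fin q') :
    (packetsAt S (fun x => host h g (a x)) v).card ≤ g * s := by
  classical
  calc _ ≤ ((Finset.univ.filter fun j : Fin q => j.1 / g = v).biUnion fun j =>
        S.filter fun x => a x = j).card := by
        refine Finset.card_le_card fun x hx => ?_
        simp only [packetsAt, Finset.mem_filter] at hx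
        simp only [Finset.mem_biUnion, Finset.mem_filter, Finset.mem_univ, true_and]
        exact ⟨a x, by rw [← hx.2]; rfl, hx.1, rfl⟩
    _ ≤ (Finset.univ.filter fun j : Fin q => j.1 / g = v).card * s :=
        Finset.card_biUnion_le_card_mul _ _ _ fun j _ => ha j
    _ ≤ g * s := Nat.mul_le_mul_right _ (card_filter_div_le _ _ hg)

variable {q' s' : ℕ} {hs : 0 < s'} {hq : n ⌈/⌉ s' ≤ q'} {cap c T g : ℕ}
  {E : Finset (Packet p π.q π.s) → List (Word p)}

theorem memory_eq_of_packetsAt_eq (hmem : π.RespectsMemory) (hqq : π.q ≤ q') {t : ℕ}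
    {X Y : Fin n → Word p} {v : Fin q'}
    (h : packetsAt (packetsOf π.s (π.memory X t)) (fun x => host hqq g x.2.1) v =
      packetsAt (packetsOf π.s (π.memory Y t)) (fun x => host hqq g x.2.1) v)
    {j : Fin π.q} (hj : host hqq g j = v) : π.memory X t j = π.memory Y t j := by
  refine eq_of_packetsOf_eq (hmem.size_memory_le X t j) (hmem.size_memory_le Y t j) fun x hx => ?_
  have := Finset.ext_iff.1 h x
  simpa [packetsAt, hx, hj] using this

/-- The simulation of one round. -/
theorem PacketReachable.simulate_round (hmem : π.RespectsMemory) (hqq : π.q ≤ q') {d k : ℕ}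
    (hc : 0 < c) (hE : Function.Injective E) (hlen : ∀ S, (E S).length = c * S.card) (hk : 0 < k)
    (hcap : k ≤ cap) (e : Fin q' ≃ (Fin d → Fin k)) (hg : 0 < g)
    (hs' : c * (g * π.s + 2 * (d * k ^ 2)) ≤ s') {t : ℕ} (ht : t < R)
    (h : PacketReachable hs hq cap E T (fun X => packetsOf π.s (π.memory X t))
      fun _ x => host hqq g x.2.1) :
    PacketReachable hs hq cap E (T + (1 + routingRounds d))
      (fun X => packetsOf π.s (π.memory X (t + 1))) fun _ x => host hqq g x.2.1 := by
  have hfrom : ∀ (X : Fin n → Word p) v, (packetsAt (packetsOf π.s (π.memory X (t + 1)))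
      (fun x => host hqq g x.1) v).card ≤ g * π.s := by
    intro X v
    refine card_packetsAt_host_le hqq hg _ _ (fun j => (card_packetsOf_from_le _ j).trans ?_) v
    -- The packets with sender `j` are the words sent by `j` in round `t`, so the bound on sent
    -- words limits the load before routing.
    have : (fun i => π.memory X (t + 1) i j) = π.sent X ⟨t, ht⟩ j := by
      funext i
      rw [Protocol.memory_succ X ht]
      rfl
    rw [this]
    exact (hmem X ⟨t, ht⟩ j).1
  rw [← add_assoc]
  refine PacketReachable.route hc hE hlen hk hcap e hs' (loc := fun _ x => host hqq g x.1)
    (fun X v => card_packetsAt_host_le hqq hg _ _ (fun j => (card_packetsOf_to_le _ j).trans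
      (hmem.size_memory_le X _ j)) v) hfrom ?_
  refine h.create hc hE hlen (hk.trans_le hcap) (fun X Y w hXY => ?_) fun X w => ?_
  · ext x
    simp only [packetsAt, Finset.mem_filter, mem_packetsOf]
    refine and_congr_left fun hx => ?_
    rw [Protocol.memory_succ X ht, Protocol.memory_succ Y ht,
      memory_eq_of_packetsAt_eq hmem hqq hXY hx]
  · refine le_trans (Nat.mul_le_mul_left _ ((hfrom X w).trans ?_)) hs'
    omega

/-- The contents of the memory of machine `j` after the last round if they contribute to the
output. -/
def Protocol.outputPart (π : Protocol n p R) (X : Fin n → Word p) (j : ℕ) : List (Word p) :=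
  if h : j < π.q then if j < n ⌈/⌉ π.s then (π.memory X R ⟨j, h⟩).concat else [] else []

theorem Protocol.outputPart_eq_nil (X : Fin n → Word p) {j : ℕ} (h : n ⌈/⌉ π.s ≤ j) :
    π.outputPart X j = [] := by
  simp [Protocol.outputPart, not_lt.2 h]

theorem Protocol.output_eq (X : Fin n → Word p) :
    π.output X = (List.range (n ⌈/⌉ π.s)).flatMap (π.outputPart X) := by
  rw [← finRange_take_flatMap π.ceilDiv_le, Protocol.output]
  refine List.flatMap_congr fun i hi => ?_
  obtain ⟨a, ha, rfl⟩ := List.mem_take_iff_getElem.1 hi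
  have h1 : a < n ⌈/⌉ π.s := (lt_min_iff.1 ha).1
  have h2 : a < π.q := by simpa using (lt_min_iff.1 ha).2
  simp [Protocol.outputPart, h1, h2]

theorem Protocol.RespectsMemory.length_outputPart_le (h : π.RespectsMemory) (X : Fin n → Word p)
    (j : ℕ) : (π.outputPart X j).length ≤ π.s := by
  unfold Protocol.outputPart
  split_ifs
  · rw [Mailbox.length_concat]
    exact h.size_memory_le X R _
  all_goals simp

/-- The round that splits the input into smaller blocks. -/
theorem reachable_spread {b M : ℕ} (hb : 0 < b) (hsM : s' = b * M) (hcap : b ≤ cap) :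
    Reachable (p := p) hs hq cap 1 fun X v w =>
      if v.1 / b = w.1 then ((List.ofFn X).drop (v * M)).take M else [] := by
  have h1 : 1 ≤ cap := hb.trans_le hcap
  refine Reachable.zero.succ (fun X Y w hXY v => ?_) (fun X w => ?_) (fun X v => ?_)
    (fun X w => ?_) fun X v => ?_
  · by_cases hv : v.1 / b = w.1
    · simp only [hv, if_true]
      have hw := congrFun hXY w
      simp only [if_true] at hw
      -- Block `v` of length `M` is the piece number `v % b` of the block of length `s' = b * M`
      -- held by machine `w = v / b`.
      have hsplit : (v : ℕ) * M = w * s' + v % b * M := by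
        conv_lhs => rw [← Nat.div_add_mod v.1 b, hv]
        rw [hsM]; ring
      have hle : v % b * M + M ≤ s' := by
        rw [hsM, ← Nat.succ_mul]
        exact Nat.mul_le_mul_right _ (Nat.mod_lt _ hb)
      rw [hsplit, ← take_drop_take_drop _ hle, hw, take_drop_take_drop _ hle]
    · simp [hv]
  · refine (Mailbox.size_le (S := Finset.univ.filter fun v : Fin q' => v.1 / b = w.1) (L := M)
      (fun j hj => ?_) fun j => ?_).trans ?_
    · simpa using fun h => absurd h (by simpa using hj)
    · split_ifs <;> simp
    · rw [hsM]
      exact Nat.mul_le_mul_right _ (card_filter_div_le _ _ hb)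
  · refine (Mailbox.size_le (S := Finset.univ.filter fun w : Fin q' => v.1 / b = w.1) (L := M)
      (fun j hj => ?_) fun j => ?_).trans ?_
    · simpa using fun h => absurd h (by simpa using hj)
    · split_ifs <;> simp
    · rw [hsM]
      exact Nat.mul_le_mul_right _ ((card_filter_val_eq_le _ _).trans hb)
  · refine (Mailbox.partners_le (S := Finset.univ.filter fun v : Fin q' => v.1 / b = w.1)
      (fun j hj => ?_)).trans ((card_filter_div_le _ _ hb).trans hcap)
    simpa using fun h => absurd h (by simpa using hj)
  · refine (Mailbox.partners_le (S := Finset.univ.filter fun w : Fin q' => v.1 / b = w.1)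
      (fun j hj => ?_)).trans ((card_filter_val_eq_le _ _).trans h1)
    simpa using fun h => absurd h (by simpa using hj)

/-- The rounds that bring the initial memories of the simulated machines to their hosts. -/
theorem packetReachable_initial (hmem : π.RespectsMemory) (hqq : π.q ≤ q') {b : ℕ}
    (hc : 0 < c) (hlen : ∀ S, (E S).length = c * S.card) (hb : 0 < b)
    (hcap : b ≤ cap) (hg : 0 < g) (hsM : s' = b * (g * π.s)) (hcb : c ≤ b) :
    PacketReachable hs hq cap E 2 (fun X => packetsOf π.s (π.memory X 0))
      fun _ x => host hqq g x.2.1 := by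
  refine (reachable_spread hb hsM hcap).create hc hlen (hb.trans_le hcap)
    (fun X Y w hXY => ?_) fun X w => ?_
  -- Host `w` received from machine `w / b` precisely the input blocks of the `g` machines that it
  -- simulates.
  · have hw := congrFun hXY ⟨w.1 / b, (Nat.div_le_self _ _).trans_lt w.2⟩
    simp only [if_true] at hw
    ext ⟨i, j, a, u⟩
    simp only [packetsAt, Finset.mem_filter, mem_packetsOf]
    refine and_congr_left fun hx => ?_
    have hj : j.1 / g = w.1 := congrArg Fin.val hx
    have hsplit : (j : ℕ) * π.s = w * (g * π.s) + j % g * π.s := by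
      conv_lhs => rw [← Nat.div_add_mod j.1 g, hj]
      ring
    have hle : j % g * π.s + π.s ≤ g * π.s := by
      rw [← Nat.succ_mul]
      exact Nat.mul_le_mul_right _ (Nat.mod_lt _ hg)
    simp only [Protocol.memory, Protocol.initial]
    rw [hsplit, ← take_drop_take_drop _ hle, hw, take_drop_take_drop _ hle]
  · rw [hsM]
    exact Nat.mul_le_mul hcb (card_packetsAt_host_le hqq hg _ _ (fun j =>
      (card_packetsOf_to_le _ j).trans (hmem.size_memory_le X _ j)) w)

/-- The round that collects the output. -/
theorem PacketReachable.gather (hmem : π.RespectsMemory) (hqq : π.q ≤ q') {b : ℕ}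
    (hE : Function.Injective E) (hb : 0 < b)
    (hcap : b ≤ cap) (hg : 0 < g) (hsM : s' = b * (g * π.s))
    (h : PacketReachable hs hq cap E T (fun X => packetsOf π.s (π.memory X R))
      fun _ x => host hqq g x.2.1) :
    Reachable hs hq cap (T + 1) fun X v w =>
      if w.1 / b = v.1 then (List.range g).flatMap fun r => π.outputPart X (w * g + r) else [] := by
  have h1 : 1 ≤ cap := hb.trans_le hcap
  have hL : ∀ (X : Fin n → Word p) (w : ℕ),
      ((List.range g).flatMap fun r => π.outputPart X (w * g + r)).length ≤ g * π.s := by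
    intro X w
    rw [List.length_flatMap]
    refine (List.sum_le_card_nsmul _ π.s fun l hl => ?_).trans (by simp)
    obtain ⟨r, -, rfl⟩ := List.mem_map.1 hl
    exact hmem.length_outputPart_le X _
  obtain ⟨prev, h⟩ := h
  refine h.succ (fun X Y w hXY v => ?_) (fun X w => ?_) (fun X v => ?_)
    (fun X w => ?_) fun X v => ?_
  · have hp := packetsAt_eq_of_encoding_eq (F := fun X => packetsOf π.s (π.memory X R))
      (loc := fun _ x => host hqq g x.2.1) hE hXY
    congr 1
    refine List.flatMap_congr fun r hr => ?_
    have hr := List.mem_range.1 hr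
    unfold Protocol.outputPart
    split_ifs with hj hj'
    · rw [memory_eq_of_packetsAt_eq hmem hqq hp]
      ext
      simp only [host]
      rw [mul_comm, Nat.mul_add_div hg, Nat.div_eq_of_lt hr, add_zero]
    all_goals rfl
  · refine (Mailbox.size_le (S := Finset.univ.filter fun v : Fin q' => w.1 / b = v.1)
      (L := g * π.s) (fun j hj => ?_) fun j => ?_).trans ?_
    · exact if_neg (by simpa using hj)
    · split_ifs
      · exact hL X w
      · simp
    · rw [hsM]
      exact Nat.mul_le_mul_right _ ((card_filter_val_eq_le _ _).trans hb)
  · refine (Mailbox.size_le (S := Finset.univ.filter fun w : Fin q' => w.1 / b = v.1)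
      (L := g * π.s) (fun j hj => ?_) fun j => ?_).trans ?_
    · exact if_neg (by simpa using hj)
    · split_ifs
      · exact hL X j
      · simp
    · rw [hsM]
      exact Nat.mul_le_mul_right _ (card_filter_div_le _ _ hb)
  · refine (Mailbox.partners_le (S := Finset.univ.filter fun v : Fin q' => w.1 / b = v.1)
      (fun j hj => ?_)).trans ((card_filter_val_eq_le _ _).trans h1)
    exact if_neg (by simpa using hj)
  · refine (Mailbox.partners_le (S := Finset.univ.filter fun w : Fin q' => w.1 / b = v.1)
      (fun j hj => ?_)).trans ((card_filter_div_le _ _ hb).trans hcap)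
    exact if_neg (by simpa using hj)

/-- Every protocol can be simulated by a protocol in which the machines, arranged in a grid,
exchange messages with few machines per round. -/
theorem Protocol.exists_simulation (π : Protocol n p R) (hmem : π.RespectsMemory)
    {f : (Fin n → Word p) → (Fin n → Word p)} (hf : π.Computes f) {d k c g : ℕ} (hk : 0 < k)
    (hqq : π.q ≤ k ^ d) (hc : 0 < c) (hcard : π.q ^ 2 * π.s * 2 ^ p ≤ (2 ^ p) ^ c) (hg : 0 < g)
    (hkg : k ^ 2 ≤ g * π.s) :
    ∃ π' : Protocol n p (R * (1 + routingRounds d) + 3), π'.q = k ^ d ∧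
      π'.s = c * (2 * d + 1) * (g * π.s) ∧ π'.RespectsMemory ∧
      π'.RespectsCapacity (k + c * (2 * d + 1)) ∧ π'.Computes f := by
  obtain ⟨b, hb⟩ : ∃ b, b = c * (2 * d + 1) := ⟨_, rfl⟩
  have hb0 : 0 < b := by rw [hb]; positivity
  have hgs : 0 < g * π.s := Nat.mul_pos hg π.s_pos
  obtain ⟨s', hs'⟩ : ∃ s', s' = b * (g * π.s) := ⟨_, rfl⟩
  have hs : 0 < s' := by rw [hs']; positivity
  rw [← hb, ← hs']
  have hceil : n ⌈/⌉ s' ≤ n ⌈/⌉ π.s := by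
    rw [ceilDiv_le_iff_le_smul hs, smul_eq_mul]
    have h1 : n ≤ π.s * (n ⌈/⌉ π.s) := by
      simpa using (ceilDiv_le_iff_le_smul π.s_pos).1 (le_refl (n ⌈/⌉ π.s))
    refine h1.trans (Nat.mul_le_mul_right _ ?_)
    rw [hs', ← mul_assoc]
    exact Nat.le_mul_of_pos_left _ (by positivity)
  have hq : n ⌈/⌉ s' ≤ k ^ d := (hceil.trans π.ceilDiv_le).trans hqq
  -- The factor `2 * d + 1` in the memory pays for the load `M + 2 * (d * k ^ 2)` with `M = g *
  -- π.s`, since `k ^ 2 ≤ g * π.s`.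
  have hload : c * (g * π.s + 2 * (d * k ^ 2)) ≤ s' := by
    calc c * (g * π.s + 2 * (d * k ^ 2)) ≤ c * (g * π.s + 2 * (d * (g * π.s))) := by gcongr
      _ = s' := by rw [hs', hb]; ring
  have hP : Fintype.card (Packet p π.q π.s) ≤ (2 ^ p) ^ c := by
    refine le_trans (le_of_eq ?_) hcard
    simp [ZMod.card]
    ring
  obtain ⟨E, hE, hlen⟩ := exists_finset_encoding hc hP
  have hcapk : k ≤ k + b := Nat.le_add_right _ _
  have hcapb : b ≤ k + b := Nat.le_add_left _ _
  have hcb : c ≤ b := by rw [hb]; exact Nat.le_mul_of_pos_right _ (by omega)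
  have key : ∀ t ≤ R, PacketReachable hs hq (k + b) E (t * (1 + routingRounds d) + 2)
      (fun X => packetsOf π.s (π.memory X t)) fun _ x => host hqq g x.2.1 := by
    intro t
    induction t with
    | zero =>
      intro _
      rw [zero_mul, zero_add]
      exact packetReachable_initial hmem hqq hc hlen hb0 hcapb hg hs' hcb
    | succ t ih =>
      intro ht
      have := (ih (by omega)).simulate_round hmem hqq hc hE hlen hk hcapk
        finFunctionFinEquiv.symm hg hload (show t < R by omega)
      convert this using 1
      ring
  obtain ⟨step, h1, h2, h3⟩ := (key R le_rfl).gather hmem hqq hE hb0 hcapb hg hs'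
  refine ⟨⟨k ^ d, s', hs, hq, step⟩, rfl, rfl, h1, h2, fun X => ?_⟩
  rw [← hf X, Protocol.output_eq (π := π)]
  have hnil : ∀ (w : ℕ), k ^ d ≤ w →
      ((List.range g).flatMap fun r => π.outputPart X (w * g + r)) = [] := by
    intro w hw
    rw [List.flatMap_eq_nil_iff]
    intro r _
    refine Protocol.outputPart_eq_nil X ((π.ceilDiv_le.trans hqq).trans (hw.trans ?_))
    exact (Nat.le_mul_of_pos_right w hg).trans (Nat.le_add_right _ _)
  have hparts : ∀ v : Fin (k ^ d), ((Protocol.mk (k ^ d) s' hs hq step).memory X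
      (R * (1 + routingRounds d) + 3) v).concat = (List.range b).flatMap fun r =>
        (List.range g).flatMap fun r' => π.outputPart X ((v * b + r) * g + r') := by
    intro v
    rw [h3 X, ← range_flatMap_ite_div hb0 hnil]
    exact Mailbox.concat_eq_range_flatMap _ _ fun j => rfl
  unfold Protocol.output
  simp only [hparts]
  rw [finRange_take_flatMap hq fun v => (List.range b).flatMap fun r =>
      (List.range g).flatMap fun r' => π.outputPart X ((v * b + r) * g + r'),
    ← range_mul_flatMap _ b fun w => (List.range g).flatMap fun r' => π.outputPart X (w * g + r'),
    ← range_mul_flatMap]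
  -- The collected parts cover at least the first `n ⌈/⌉ π.s` simulated machines; the surplus parts
  -- are empty.
  refine range_flatMap_eq_of_le ?_ fun i hi => Protocol.outputPart_eq_nil X hi
  rw [ceilDiv_le_iff_le_smul π.s_pos, smul_eq_mul]
  have h4 : n ≤ s' * (n ⌈/⌉ s') := by
    simpa using (ceilDiv_le_iff_le_smul hs).1 (le_refl (n ⌈/⌉ s'))
  refine h4.trans (le_of_eq ?_)
  rw [hs']
  ring

end Simulation

/-! ### Choice of parameters and asymptotics. -/

theorem exists_pow_near {d : ℕ} (hd : 0 < d) {q : ℕ} (hq : 0 < q) :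
    ∃ k, 0 < k ∧ q ≤ k ^ d ∧ k ^ d ≤ 2 ^ d * q := by
  classical
  have hex : ∃ k, q ≤ k ^ d := ⟨q, Nat.le_self_pow hd.ne' q⟩
  obtain ⟨k, hk⟩ : ∃ k, k = Nat.find hex := ⟨_, rfl⟩
  have hqk : q ≤ k ^ d := hk ▸ Nat.find_spec hex
  have hk0 : 0 < k := by
    rcases Nat.eq_zero_or_pos k with h | h
    · rw [h, zero_pow hd.ne'] at hqk; omega
    · exact h
  refine ⟨k, hk0, hqk, ?_⟩
  rcases Nat.lt_or_ge 1 k with h1 | h1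
  · have hlt : (k - 1) ^ d < q := by
      have := Nat.find_min hex (m := k - 1) (by omega)
      omega
    -- By minimality `(k - 1) ^ d < q`, and `k ≤ 2 * (k - 1)` as `k ≥ 2`.
    calc k ^ d ≤ (2 * (k - 1)) ^ d := Nat.pow_le_pow_left (by omega) d
      _ = 2 ^ d * (k - 1) ^ d := mul_pow _ _ _
      _ ≤ 2 ^ d * q := Nat.mul_le_mul_left _ hlt.le
  · have : k = 1 := by omega
    rw [this, one_pow]
    exact Nat.mul_pos (by positivity) hq

theorem Protocol.q_pos {n p R : ℕ} (π : Protocol n p R) (hn : 0 < n) : 0 < π.q := by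
  rcases Nat.eq_zero_or_pos π.q with h | h
  · have := (ceilDiv_le_iff_le_smul π.s_pos).1 π.ceilDiv_le
    rw [h, smul_zero] at this
    omega
  · exact h

/-- A protocol with bounded capacity for a single input size. The parameter `m` is a lower bound for
the local memory. If the conditions on the parameters fail, it is the original protocol. -/
theorem Protocol.exists_restricted {n p R : ℕ} (π : Protocol n p R) (hmem : π.RespectsMemory)
    {f : (Fin n → Word p) → (Fin n → Word p)} (hf : π.Computes f) {d c : ℕ} (m : ℕ) (hd : 0 < d)
    (hc : 0 < c) :
    ∃ R' ≤ R * (d ^ 2 + 4), ∃ (π' : Protocol n p R') (κ : ℕ), π'.RespectsMemory ∧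
      π'.RespectsCapacity κ ∧ π'.Computes f ∧
      (0 < π.q → (∀ k, k ^ d ≤ 2 ^ d * π.q → k ^ 2 ≤ m) →
        π.q ^ 2 * π.s * 2 ^ p ≤ (2 ^ p) ^ c →
        π.q ≤ π'.q ∧ π'.q ≤ 2 ^ d * π.q ∧ π'.s ≤ c * (2 * d + 1) * (m + π.s) ∧
        ∃ k, k ^ d ≤ 2 ^ d * π.q ∧ κ ≤ k + c * (2 * d + 1)) := by
  have hRle : R ≤ R * (d ^ 2 + 4) := Nat.le_mul_of_pos_right _ (by omega)
  by_cases hgood : 0 < π.q ∧ (∀ k, k ^ d ≤ 2 ^ d * π.q → k ^ 2 ≤ m) ∧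
      π.q ^ 2 * π.s * 2 ^ p ≤ (2 ^ p) ^ c
  · obtain ⟨hq, hm, hcard⟩ := hgood
    rcases Nat.eq_zero_or_pos R with rfl | hR
    -- Without rounds there is no communication, and the three extra rounds could not be absorbed.
    · refine ⟨0, hRle, π, 0, hmem, fun _ t => t.elim0, hf, fun _ _ _ => ⟨le_rfl, ?_, ?_, 0, ?_, ?_⟩⟩
      · exact Nat.le_mul_of_pos_left _ (by positivity)
      · exact (Nat.le_add_left _ _).trans (Nat.le_mul_of_pos_left _ (by positivity))
      · simp [hd.ne']
      · exact Nat.zero_le _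
    · obtain ⟨k, hk, hqk, hkq⟩ := exists_pow_near hd hq
      have hlow : m ≤ (m / π.s + 1) * π.s := by
        have := Nat.lt_div_mul_add (a := m) π.s_pos
        rw [add_mul, one_mul]
        exact this.le
      have hupp : (m / π.s + 1) * π.s ≤ m + π.s := by
        rw [add_mul, one_mul]
        exact Nat.add_le_add_right (Nat.div_mul_le_self _ _) _
      -- This `g` brings `g * π.s` between `m` and `m + π.s`.
      obtain ⟨π', h1, h2, h3, h4, h5⟩ := π.exists_simulation hmem hf hk hqk hc hcard
        (g := m / π.s + 1) (Nat.succ_pos _) ((hm k hkq).trans hlow)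
      refine ⟨_, ?_, π', _, h3, h4, h5, fun _ _ _ => ⟨by rwa [h1], by rwa [h1], ?_, k, hkq, le_rfl⟩⟩
      · calc R * (1 + routingRounds d) + 3 ≤ R * (1 + d ^ 2) + R * 3 := by
              gcongr
              · exact routingRounds_le d
              · omega
          _ = _ := by ring
      · rw [h2]
        exact Nat.mul_le_mul_left _ hupp
  · refine ⟨R, hRle, π, π.q, hmem, fun X t i => ?_, hf, fun h1 h2 h3 => absurd ⟨h1, h2, h3⟩ hgood⟩
    constructor <;> exact (Finset.card_le_univ _).trans (by simp)

theorem exists_le_mul_of_isBigO {u v : ℕ → ℝ} (h : u =O[atTop] v) (hv : ∀ n, 0 ≤ v n) :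
    ∃ A, 1 ≤ A ∧ ∀ᶠ n in atTop, u n ≤ A * v n := by
  obtain ⟨A, hA⟩ := h.bound
  refine ⟨max A 1, le_max_right _ _, hA.mono fun n hn => ?_⟩
  rw [Real.norm_of_nonneg (hv n)] at hn
  exact (Real.le_norm_self _).trans
    (hn.trans (mul_le_mul_of_nonneg_right (le_max_left _ _) (hv n)))

theorem eventually_mul_rpow_le {a b : ℝ} (h : a < b) (K : ℝ) :
    ∀ᶠ n : ℕ in atTop, K * (n : ℝ) ^ a ≤ (n : ℝ) ^ b := by
  have h1 := ((tendsto_rpow_atTop (sub_pos.2 h)).comp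
    tendsto_natCast_atTop_atTop).eventually_ge_atTop K
  filter_upwards [h1, eventually_gt_atTop 0] with n hn hn0
  have hpos : (0 : ℝ) < n := by exact_mod_cast hn0
  calc K * (n : ℝ) ^ a ≤ (n : ℝ) ^ (b - a) * (n : ℝ) ^ a :=
        mul_le_mul_of_nonneg_right hn (Real.rpow_nonneg hpos.le _)
    _ = (n : ℝ) ^ b := by rw [← Real.rpow_add hpos]; ring_nf

theorem rpow_two_mul {x : ℝ} (hx : 0 ≤ x) (a : ℝ) : x ^ (2 * a) = (x ^ a) ^ 2 := by
  rw [mul_comm, Real.rpow_mul hx, Real.rpow_two]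

/-- Polynomially many values can be encoded by a constant number of words of logarithmic length. -/
theorem exists_words_encode {p : ℕ → ℕ} (hp : (fun n => (p n : ℝ)) =Θ[atTop] fun n : ℕ => Real.log n)
    (a : ℝ) : ∃ N : ℕ, ∀ᶠ n : ℕ in atTop, (n : ℝ) ^ a ≤ ((2 : ℝ) ^ p n) ^ N := by
  obtain ⟨A, hA, hlog⟩ := exists_le_mul_of_isBigO hp.isBigO_symm fun n => Nat.cast_nonneg _
  obtain ⟨N, hN⟩ := exists_nat_ge (max a 0 * A / Real.log 2)
  refine ⟨N, ?_⟩
  filter_upwards [hlog, eventually_gt_atTop 0] with n hn hn0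
  have hpos : (0 : ℝ) < n := by exact_mod_cast hn0
  have h1n : (1 : ℝ) ≤ n := by exact_mod_cast hn0
  have h2 : 0 < Real.log 2 := Real.log_pos (by norm_num)
  rw [div_le_iff₀ h2] at hN
  rw [← Real.log_le_log_iff (by positivity) (by positivity), Real.log_rpow hpos, Real.log_pow,
    Real.log_pow]
  have hlogn : 0 ≤ Real.log n := Real.log_nonneg h1n
  calc a * Real.log n ≤ max a 0 * Real.log n :=
        mul_le_mul_of_nonneg_right (le_max_left _ _) hlogn
    _ ≤ max a 0 * (A * p n) := mul_le_mul_of_nonneg_left hn (le_max_right _ _)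
    _ = max a 0 * A * p n := by ring
    _ ≤ N * Real.log 2 * p n := mul_le_mul_of_nonneg_right hN (Nat.cast_nonneg _)
    _ = _ := by ring

/-- Otherwise the number of machines would tend to zero, although a nonempty input needs a machine.
The resulting `δ ≤ 1 + γ` makes `(1 + γ) / ρ` at least one, so that additive constants can be
absorbed into its square. -/
theorem IsMPC.exponent_nonneg {γ δ : ℝ} {p R : ℕ → ℕ} {π : ∀ n, Protocol n (p n) (R n)}
    (h : IsMPC γ δ π) : 0 ≤ 1 + γ - δ := by
  by_contra! hneg
  have h1 : Tendsto (fun n : ℕ => (n : ℝ) ^ (1 + γ - δ)) atTop (nhds 0) := by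
    have := (tendsto_rpow_neg_atTop (neg_pos.2 hneg)).comp
      (tendsto_natCast_atTop_atTop (R := ℝ))
    simpa [Function.comp_def] using this
  have h2 := h.machines.1.trans_tendsto h1
  obtain ⟨n, hn, hn0⟩ := ((h2.eventually_lt_const one_pos).and (eventually_gt_atTop 0)).exists
  have : 0 < (π n).q := (π n).q_pos hn0
  have : (1 : ℝ) ≤ (π n).q := by exact_mod_cast this
  linarith

/-- A protocol can be transformed into one with bounded capacity. -/
theorem IsMPC.exists_isRestrictedMPC {γ δ ρ : ℝ} (hρ : 0 < ρ) (hρδ : ρ < δ / 2)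
    {p R : ℕ → ℕ} {f : ∀ n : ℕ, (Fin n → Word (p n)) → (Fin n → Word (p n))}
    {π : ∀ n, Protocol n (p n) (R n)} (hπ : IsMPC γ δ π) (hf : ∀ n, (π n).Computes (f n)) :
    ∃ R' : ℕ → ℕ, (∀ n, (R' n : ℝ) ≤ 8 * (R n * (1 + γ) ^ 2 / ρ ^ 2)) ∧
      ∃ π' : ∀ n, Protocol n (p n) (R' n),
        IsRestrictedMPC γ δ ρ π' ∧ ∀ n, (π' n).Computes (f n) := by
  have hα := hπ.exponent_nonneg
  have hD : 1 ≤ (1 + γ) / ρ := by rw [le_div_iff₀ hρ]; linarith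
  obtain ⟨d, hd⟩ : ∃ d, d = ⌈(1 + γ) / ρ⌉₊ := ⟨_, rfl⟩
  have hd0 : 0 < d := hd ▸ Nat.ceil_pos.2 (by linarith)
  have hdl : (1 + γ) / ρ ≤ d := hd ▸ Nat.le_ceil _
  have hdu : (d : ℝ) ≤ 2 * ((1 + γ) / ρ) := by
    have := Nat.ceil_lt_add_one (a := (1 + γ) / ρ) (by linarith)
    rw [← hd] at this
    linarith
  have hαd : 1 + γ - δ ≤ ρ * d := by
    rw [div_le_iff₀ hρ] at hdl
    linarith
  have hnn : ∀ (a : ℝ) (n : ℕ), 0 ≤ (n : ℝ) ^ a := fun a n => by positivity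
  obtain ⟨A, hA1, hA⟩ := exists_le_mul_of_isBigO hπ.machines.1 (hnn _)
  obtain ⟨B, hB1, hB⟩ := exists_le_mul_of_isBigO hπ.localMemory (hnn _)
  -- The labels take `q ^ 2 * s = O(n ^ (2 * (1 + γ - δ) + δ))` values; the additional `1` in the
  -- exponent absorbs the constant. One further word, hence `c = N + 1`, carries the content.
  obtain ⟨N, hN⟩ := exists_words_encode hπ.wordBits (2 * (1 + γ - δ) + δ + 1)
  obtain ⟨b, hb⟩ : ∃ b, b = (N + 1) * (2 * d + 1) := ⟨_, rfl⟩
  choose R' hR' π' κ hmem hcap hcomp hgood using fun n =>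
    (π n).exists_restricted (hπ.respectsMemory n) (hf n) (d := d) (c := N + 1) ⌈(n : ℝ) ^ δ⌉₊ hd0
      (Nat.succ_pos N)
  have hk : ∀ᶠ n : ℕ in atTop, ∀ k : ℕ, k ^ d ≤ 2 ^ d * (π n).q →
      (k : ℝ) ≤ 2 * A * (n : ℝ) ^ ρ := by
    filter_upwards [hA, eventually_gt_atTop 0] with n hn hn0 k hkq
    have h1n : (1 : ℝ) ≤ n := by exact_mod_cast hn0
    refine le_of_pow_le_pow_left₀ hd0.ne' (by positivity) ?_
    calc (k : ℝ) ^ d ≤ 2 ^ d * (π n).q := by exact_mod_cast hkq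
      _ ≤ 2 ^ d * (A * (n : ℝ) ^ (1 + γ - δ)) := by gcongr
      -- The choice of `d` gives `1 + γ - δ ≤ ρ * d`.
      _ ≤ 2 ^ d * (A ^ d * (n : ℝ) ^ (ρ * d)) := by
          gcongr
          exact le_self_pow₀ hA1 hd0.ne'
      _ = (2 * A * (n : ℝ) ^ ρ) ^ d := by
          rw [Real.rpow_mul_natCast (by positivity)]; ring
  have hev : ∀ᶠ n : ℕ in atTop, (π n).q ≤ (π' n).q ∧ (π' n).q ≤ 2 ^ d * (π n).q ∧
      (π' n).s ≤ b * (⌈(n : ℝ) ^ δ⌉₊ + (π n).s) ∧ ∃ k, k ^ d ≤ 2 ^ d * (π n).q ∧ κ n ≤ k + b := by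
    filter_upwards [hA, hB, hN, hk, eventually_gt_atTop 0,
      eventually_mul_rpow_le (show 2 * ρ < δ by linarith) ((2 * A) ^ 2),
      eventually_mul_rpow_le (show 2 * (1 + γ - δ) + δ < 2 * (1 + γ - δ) + δ + 1 by linarith)
        (A ^ 2 * B)] with n hAn hBn hNn hkn hn0 h1 h2
    have hpos : (0 : ℝ) < n := by exact_mod_cast hn0
    rw [hb]
    refine hgood n ((π n).q_pos hn0) (fun k hkq => ?_) ?_
    · have h3 : ((k ^ 2 : ℕ) : ℝ) ≤ (⌈(n : ℝ) ^ δ⌉₊ : ℝ) := by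
        push_cast
        calc (k : ℝ) ^ 2 ≤ (2 * A * (n : ℝ) ^ ρ) ^ 2 := by
              gcongr
              exact hkn k hkq
          _ = (2 * A) ^ 2 * (n : ℝ) ^ (2 * ρ) := by
              rw [rpow_two_mul hpos.le]; ring
          _ ≤ _ := h1.trans (Nat.le_ceil _)
      exact_mod_cast h3
    · have h3 : (((π n).q ^ 2 * (π n).s : ℕ) : ℝ) ≤ (((2 ^ p n) ^ N : ℕ) : ℝ) := by
        push_cast
        calc ((π n).q : ℝ) ^ 2 * (π n).s
            ≤ (A * (n : ℝ) ^ (1 + γ - δ)) ^ 2 * (B * (n : ℝ) ^ δ) := by gcongr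
          _ = A ^ 2 * B * (n : ℝ) ^ (2 * (1 + γ - δ) + δ) := by
              rw [Real.rpow_add hpos, rpow_two_mul hpos.le]; ring
          _ ≤ _ := h2.trans hNn
      rw [pow_succ]
      exact Nat.mul_le_mul_right _ (by exact_mod_cast h3)
  refine ⟨R', fun n => ?_, π', ⟨⟨hπ.wordBits, ⟨?_, ?_⟩, ?_, hmem⟩, κ, ?_, hcap⟩, hcomp⟩
  -- With `D = (1 + γ) / ρ ≥ 1` and `d ≤ 2 * D`, this is `4 * D ^ 2 + 4 ≤ 8 * D ^ 2`, the source of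
  -- the constant 8.
  · have h1 : (d : ℝ) ^ 2 + 4 ≤ 8 * ((1 + γ) / ρ) ^ 2 := by nlinarith
    calc (R' n : ℝ) ≤ R n * ((d : ℝ) ^ 2 + 4) := by exact_mod_cast hR' n
      _ ≤ R n * (8 * ((1 + γ) / ρ) ^ 2) := by gcongr
      _ = _ := by rw [div_pow]; ring
  · refine IsBigO.trans (IsBigO.of_bound (2 ^ d) ?_) hπ.machines.1
    filter_upwards [hev] with n hn
    rw [Real.norm_natCast, Real.norm_natCast]
    exact_mod_cast hn.2.1
  · refine hπ.machines.2.trans (IsBigO.of_bound 1 ?_)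
    filter_upwards [hev] with n hn
    rw [Real.norm_natCast, Real.norm_natCast, one_mul]
    exact_mod_cast hn.1
  · refine IsBigO.of_bound (b * (2 + B)) ?_
    filter_upwards [hev, hB, eventually_gt_atTop 0] with n hn hBn hn0
    have h1n : (1 : ℝ) ≤ n := by exact_mod_cast hn0
    have h1 : 1 ≤ (n : ℝ) ^ δ := Real.one_le_rpow h1n (by linarith)
    have h2 := Nat.ceil_lt_add_one (hnn δ n)
    rw [Real.norm_natCast, Real.norm_of_nonneg (hnn δ n)]
    calc ((π' n).s : ℝ) ≤ b * (⌈(n : ℝ) ^ δ⌉₊ + (π n).s) := by exact_mod_cast hn.2.2.1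
      _ ≤ b * (2 * (n : ℝ) ^ δ + B * (n : ℝ) ^ δ) := by gcongr; linarith
      _ = _ := by ring
  · refine IsBigO.of_bound (2 * A + b) ?_
    filter_upwards [hev, hk, eventually_gt_atTop 0] with n hn hkn hn0
    have h1n : (1 : ℝ) ≤ n := by exact_mod_cast hn0
    have h1 : 1 ≤ (n : ℝ) ^ ρ := Real.one_le_rpow h1n hρ.le
    obtain ⟨k, hkq, hκ⟩ := hn.2.2.2
    rw [Real.norm_natCast, Real.norm_of_nonneg (hnn ρ n)]
    calc (κ n : ℝ) ≤ k + b := by exact_mod_cast hκ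
      _ ≤ 2 * A * (n : ℝ) ^ ρ + b * (n : ℝ) ^ ρ := by
          gcongr
          · exact hkn k hkq
          · exact le_mul_of_one_le_right (Nat.cast_nonneg _) h1
      _ = _ := by ring

end MPC

theorem mainTheorem9 :
    ∃ C : ℝ, 0 < C ∧
      ∀ γ δ ρ : ℝ, 0 < γ → 0 < δ → 0 < ρ → ρ < δ / 2 →
        ∀ (p R : ℕ → ℕ)
          (f : ∀ n : ℕ, (Fin n → MPC.Word (p n)) → (Fin n → MPC.Word (p n))),
          (∃ π : ∀ n, MPC.Protocol n (p n) (R n),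
            MPC.IsMPC γ δ π ∧ ∀ n, (π n).Computes (f n)) →
          ∃ R' : ℕ → ℕ,
            (∀ n, (R' n : ℝ) ≤ C * (R n * (1 + γ) ^ 2 / ρ ^ 2)) ∧
            ∃ π' : ∀ n, MPC.Protocol n (p n) (R' n),
              MPC.IsRestrictedMPC γ δ ρ π' ∧ ∀ n, (π' n).Computes (f n) := by
  refine ⟨8, by norm_num, fun γ δ ρ _ _ hρ hρδ p R f ⟨π, hπ, hf⟩ => ?_⟩
  exact hπ.exists_isRestrictedMPC hρ hρδ hf
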